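/- Let $r,s,t,u\in\mathbb{Z}$ satisfy $ru-st=\pm 1$ and $rstu\neq 0$, and let $$G=\langle a_1,b_1,a_2 \mid a_1b_1a_1^{-1}=b_1^{-1},\ a_2^2=a_1^{2r}b_1^{s},\ a_2a_1^{2t}b_1^{u}a_2^{-1}=b_1^{-u}a_1^{-2t}\rangle$$ (the fundamental group of the torus semi-bundle, or sapphire, $K(r,s,t,u)$). Let $\eta\colon G\to\operatorname{Aut}(\mathbb{Z})=\{1,-1\}$ be a homomorphism with $\eta(b_1)=-1$, and let $\mathbb{Z}_\eta$ be the $G$-module with underlying abelian group $\mathbb{Z}$ and action $g\cdot n=\eta(g)\,n$. Then $s$ is even, and the cohomology groups of $G$ with coefficients in $\mathbb{Z}_\eta$ satisfy $$H^0(G;\mathbb{Z}_\eta)=0,\qquad H^1(G;\mathbb{Z}_\eta)\cong\mathbb{Z}_2,\qquad H^2(G;\mathbb{Z}_\eta)\cong\mathbb{Z}_2\oplus\mathbb{Z}_2,\qquad H^3(G;\mathbb{Z}_\eta)\cong\mathbb{Z}_2,$$ where $\mathbb{Z}_2=\mathbb{Z}/2\mathbb{Z}$. -/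

import Mathlib

namespace Sapphire

/-- The three generators `a₁, b₁, a₂`. -/
inductive Gen : Type
  | a₁
  | b₁
  | a₂

/-- The relators of the fundamental group of the sapphire `K(r,s,t,u)`; a relation `l = m` is
recorded as the relator `l * m⁻¹`:
`a₁ b₁ a₁⁻¹ = b₁⁻¹`, `a₂² = a₁^(2r) b₁^s`, `a₂ (a₁^(2t) b₁^u) a₂⁻¹ = b₁^(-u) a₁^(-2t)`. -/
def rels (r s t u : ℤ) : Set (FreeGroup Gen) :=
  let a₁ : FreeGroup Gen := FreeGroup.of Gen.a₁
  let b₁ : FreeGroup Gen := FreeGroup.of Gen.b₁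
  let a₂ : FreeGroup Gen := FreeGroup.of Gen.a₂
  { (a₁ * b₁ * a₁⁻¹) * (b₁⁻¹)⁻¹,
    a₂ ^ 2 * (a₁ ^ (2 * r) * b₁ ^ s)⁻¹,
    (a₂ * a₁ ^ (2 * t) * b₁ ^ u * a₂⁻¹) * (b₁ ^ (-u) * a₁ ^ (-2 * t))⁻¹ }

/-- The group `G = ⟨a₁, b₁, a₂ ∣ rels⟩`, the fundamental group of the torus semi-bundle
`K(r,s,t,u)`. -/
abbrev G (r s t u : ℤ) : Type := PresentedGroup (rels r s t u)

/-- The element `b₁` of `G`. -/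
def b₁ (r s t u : ℤ) : G r s t u := PresentedGroup.of Gen.b₁

/-- For `η : Γ → Aut(ℤ) = {1, -1}`, the representation of `Γ` on `ℤ` with `g • n = η(g) n`. -/
def twistedRep {Γ : Type} [Group Γ] (η : Γ →* ℤˣ) : Representation ℤ Γ ℤ where
  toFun g := ((η g : ℤˣ) : ℤ) • (LinearMap.id : ℤ →ₗ[ℤ] ℤ)
  map_one' := by ext; simp
  map_mul' g h := by ext; simp

/-- The `Γ`-module `ℤ_η`. -/
noncomputable def twistedInt {Γ : Type} [Group Γ] (η : Γ →* ℤˣ) : Rep ℤ Γ :=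
  Rep.of (twistedRep η)

end Sapphire

/-!
`G` is the amalgam of two Klein bottle groups `⟨a₁, b₁⟩` and `⟨a₂, b₂⟩`, `b₂ = a₁^{2t} b₁^u`, over
the common torus group `T = ⟨a₁², b₁⟩`. Here `T` is normal with `G/T` the infinite dihedral group,
so `G` acts on the line: `a₁` and `a₂` act as the reflections in two adjacent vertices and `b₁`
trivially. The stabilisers are the two Klein bottle groups (vertices) and `T` (edges)
(`cohomology_even_vertex`, `cohomology_odd_vertex`, `cohomology_edge`). As the line is a tree, the
functions on its vertices and edges with values in `ℤ_η` form a short exact sequence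
`0 → ℤ_η → Fun(V) → Fun(E) → 0` (`exists_line_sequence`). By Shapiro's lemma
(`nonempty_groupCohomology_funRep`) its long exact sequence expresses the cohomology of `G` through
that of the stabilisers.

The stabilisers have the form `⟨b⟩ ⋊ ⟨a⟩`, and the same method applies to them, and then to
`⟨b⟩ ≅ ℤ`, with the line acted on by translations (`exists_wang_sequence`). That `a` and `b` have no
further relations follows from an affine action of `G` on `ℤ²` (`torus_free`).

None of the maps in these sequences has to be identified; orders suffice. For each of the groups
involved, a crossed homomorphism into `ℤ_η` vanishing at an element `b` with `η b = -1` vanishes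
identically, and `(η - 1)/2` is a crossed homomorphism which is odd at `b`, so `H¹` has order two
(`natCard_H1_twistedInt`). For `⟨b⟩ ⋊ ⟨a⟩` this forces `H²` to have order two and `H³` to vanish
(`cohomology_of_zpow_mul_zpow`). For `G` it makes `H¹(V) → H¹(E)` onto, hence `H²(G) → H²(V)`
injective, where `H²(V) ≅ (ℤ/2)²`. Since the three generators of `G` can be sent to `ℤ/2`
arbitrarily (`s` is even), the Bockstein sequence of `0 → ℤ_η → ℤ_η → ℤ/2 → 0` produces four
elements of `H²(G)` (`four_le_natCard_H2`). Therefore `H²(G) ≅ H²(V)`, the map `H²(V) → H²(E)` is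
zero, and `H³(G) ≅ H²(E) ≅ ℤ/2`, as `H³(V) = 0`.
-/

open CategoryTheory

namespace Sapphire

/-! ### Long exact sequences and Shapiro's lemma for function modules -/

section Homological

variable {k Γ : Type} [CommRing k] [Group Γ]

/-- The long exact cohomology sequence of a short exact sequence of representations, with all
maps left anonymous. -/
theorem exists_long_exact {A B C : Rep.{0} k Γ} (f : A ⟶ B) (g : B ⟶ C)
    (hf : Function.Injective f.hom) (hfg : Function.Exact f.hom g.hom)
    (hg : Function.Surjective g.hom) :
    ∃ (φ : ∀ n, groupCohomology A n →+ groupCohomology B n)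
      (ψ : ∀ n, groupCohomology B n →+ groupCohomology C n)
      (δ : ∀ n, groupCohomology C n →+ groupCohomology A (n + 1)),
      (∀ n, Function.Exact (φ n) (ψ n)) ∧ (∀ n, Function.Exact (ψ n) (δ n)) ∧
      ∀ n, Function.Exact (δ n) (φ (n + 1)) := by
  have w : f ≫ g = 0 := by
    ext x
    exact hfg.apply_apply_eq_zero x
  let X : ShortComplex (Rep.{0} k Γ) := ⟨f, g, w⟩
  have hX : X.ShortExact :=
    { exact := by
        rw [← ShortComplex.exact_map_iff_of_faithful X (forget₂ (Rep.{0} k Γ) (ModuleCat k)),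
          ShortComplex.ShortExact.moduleCat_exact_iff_function_exact]
        exact hfg
      mono_f := (Rep.mono_iff_injective f).2 hf
      epi_g := (Rep.epi_iff_surjective g).2 hg }
  refine ⟨fun n => (groupCohomology.map (.id Γ) f n).hom.toAddMonoidHom,
    fun n => (groupCohomology.map (.id Γ) g n).hom.toAddMonoidHom,
    fun n => (groupCohomology.δ hX n (n + 1) rfl).hom.toAddMonoidHom, fun n => ?_, fun n => ?_,
    fun n => ?_⟩
  · exact (ShortComplex.ShortExact.moduleCat_exact_iff_function_exact _).1
      (groupCohomology.mapShortComplex₂_exact hX n)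
  · exact (ShortComplex.ShortExact.moduleCat_exact_iff_function_exact _).1
      (groupCohomology.mapShortComplex₃_exact hX rfl)
  · exact (ShortComplex.ShortExact.moduleCat_exact_iff_function_exact _).1
      (groupCohomology.mapShortComplex₁_exact hX rfl)

/-- Cohomology is additive in the coefficients: `Hⁿ(Γ, V × W) ≃ Hⁿ(Γ, V) × Hⁿ(Γ, W)`. -/
theorem nonempty_groupCohomology_prod {V W : Type} [AddCommGroup V] [Module k V] [AddCommGroup W]
    [Module k W] (ρ : Representation k Γ V) (σ : Representation k Γ W) (n : ℕ) :
    Nonempty (groupCohomology (Rep.of (ρ.prod σ)) n ≃+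
      groupCohomology (Rep.of ρ) n × groupCohomology (Rep.of σ) n) := by
  let p₁ : Rep.of (ρ.prod σ) ⟶ Rep.of ρ := Rep.ofHom ⟨LinearMap.fst k V W, fun _ => rfl⟩
  let p₂ : Rep.of (ρ.prod σ) ⟶ Rep.of σ := Rep.ofHom ⟨LinearMap.snd k V W, fun _ => rfl⟩
  let i₁ : Rep.of ρ ⟶ Rep.of (ρ.prod σ) :=
    Rep.ofHom ⟨LinearMap.inl k V W, fun g => by ext <;> simp⟩
  let i₂ : Rep.of σ ⟶ Rep.of (ρ.prod σ) :=
    Rep.ofHom ⟨LinearMap.inr k V W, fun g => by ext <;> simp⟩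
  let F := groupCohomology.cochainsFunctor k Γ ⋙
    HomologicalComplex.homologyFunctor (ModuleCat k) (.up ℕ) n
  have h₁₁ : F.map i₁ ≫ F.map p₁ = 𝟙 _ := by
    rw [← F.map_comp, show i₁ ≫ p₁ = 𝟙 _ from rfl, F.map_id]
  have h₂₂ : F.map i₂ ≫ F.map p₂ = 𝟙 _ := by
    rw [← F.map_comp, show i₂ ≫ p₂ = 𝟙 _ from rfl, F.map_id]
  have h₁₂ : F.map i₁ ≫ F.map p₂ = 0 := by
    rw [← F.map_comp, show i₁ ≫ p₂ = 0 from rfl, F.map_zero]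
  have h₂₁ : F.map i₂ ≫ F.map p₁ = 0 := by
    rw [← F.map_comp, show i₂ ≫ p₁ = 0 from rfl, F.map_zero]
  have hsum : F.map p₁ ≫ F.map i₁ + F.map p₂ ≫ F.map i₂ = 𝟙 _ := by
    rw [← F.map_comp, ← F.map_comp, ← F.map_add, ← F.map_id]
    congr 1
    refine Rep.hom_ext (Representation.IntertwiningMap.ext (LinearMap.ext fun x => ?_))
    exact Prod.ext (add_zero x.1) (zero_add x.2)
  refine ⟨{
    toFun := fun x => ((F.map p₁).hom x, (F.map p₂).hom x)
    invFun := fun y => (F.map i₁).hom y.1 + (F.map i₂).hom y.2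
    left_inv := fun x => congr($(hsum).hom x)
    right_inv := fun y => ?_
    map_add' := fun x y => Prod.ext (map_add (F.map p₁).hom x y) (map_add (F.map p₂).hom x y) }⟩
  have e₁ (x) : (F.map p₁).hom ((F.map i₁).hom x) = x := congr($(h₁₁).hom x)
  have e₂ (x) : (F.map p₂).hom ((F.map i₂).hom x) = x := congr($(h₂₂).hom x)
  have e₃ (x) : (F.map p₂).hom ((F.map i₁).hom x) = 0 := congr($(h₁₂).hom x)
  have e₄ (x) : (F.map p₁).hom ((F.map i₂).hom x) = 0 := congr($(h₂₁).hom x)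
  refine Prod.ext ((map_add (F.map p₁).hom _ _).trans ?_) ((map_add (F.map p₂).hom _ _).trans ?_)
  · exact (congrArg₂ (· + ·) (e₁ _) (e₄ _)).trans (add_zero _)
  · exact (congrArg₂ (· + ·) (e₃ _) (e₂ _)).trans (zero_add _)

/-- For an action `φ` of `Γ` on a set `X`, the functions `X → V` with values in a representation
`σ`, with the diagonal action `(g • F) x = g • F (g⁻¹ • x)`. -/
def funRep {X V : Type} [AddCommGroup V] [Module k V] (φ : Γ →* Equiv.Perm X)
    (σ : Representation k Γ V) : Representation k Γ (X → V) where
  toFun g := (σ g).compLeft X ∘ₗ LinearMap.funLeft k V (φ g⁻¹)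
  map_one' := by
    ext F x
    simp
  map_mul' g h := by
    ext F x
    simp

theorem funRep_apply {X V : Type} [AddCommGroup V] [Module k V] (φ : Γ →* Equiv.Perm X)
    (σ : Representation k Γ V) (g : Γ) (F : X → V) (x : X) :
    funRep φ σ g F x = σ g (F ((φ g).symm x)) := by
  simp [funRep, ← Equiv.Perm.inv_def]

/-- Shapiro's lemma for a transitive action: `Hⁿ(Γ, X → V)` is the cohomology of the stabiliser of
a point with coefficients in `V`. -/
theorem nonempty_groupCohomology_funRep {X V : Type} [AddCommGroup V] [Module k V]
    (φ : Γ →* Equiv.Perm X) (σ : Representation k Γ V) (x₀ : X) (S : Subgroup Γ)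
    (hS : ∀ g, g ∈ S ↔ φ g x₀ = x₀) (htrans : ∀ x, ∃ g, φ g x₀ = x) (n : ℕ) :
    Nonempty (groupCohomology (Rep.of (funRep φ σ)) n ≃+
      groupCohomology (Rep.of (σ.comp S.subtype)) n) := by
  -- A function `F` corresponds to the `S`-equivariant map `g ↦ g • F (g⁻¹ • x₀)`.
  let e : (X → V) →ₗ[k] Representation.coindV S.subtype (σ.comp S.subtype) :=
    { toFun F := ⟨fun g => σ g (F ((φ g).symm x₀)), fun s g => by
        have : (φ (s : Γ)).symm x₀ = x₀ := by
          rw [Equiv.symm_apply_eq, (hS s).1 s.2]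
        simp [Equiv.Perm.mul_def, this]⟩
      map_add' F F' := by
        ext g
        simp
      map_smul' c F := by
        ext g
        simp }
  have he : Function.Bijective e := by
    have hσ (g : Γ) (v : V) : σ g⁻¹ (σ g v) = v := by simp
    constructor
    · intro F F' h
      ext x
      obtain ⟨g, rfl⟩ := htrans x
      have := congr_fun (congr_arg Subtype.val h) g⁻¹
      simpa [e, Equiv.Perm.inv_def] using congr_arg (σ g) this
    · intro f
      choose γ hγ using htrans
      refine ⟨fun x => σ (γ x) (f.1 (γ x)⁻¹), Subtype.ext (funext fun g => ?_)⟩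
      -- `g γ` fixes `x₀`, so equivariance compares the values of `f` at `γ⁻¹` and at `g`.
      set c := γ ((φ g).symm x₀) with hc
      have hmem : g * c ∈ S := by
        rw [hS]
        simp [hc, hγ]
      have := f.2 ⟨g * c, hmem⟩ c⁻¹
      simp only [Subgroup.subtype_apply, mul_inv_cancel_right] at this
      simp only [e, LinearMap.coe_mk, AddHom.coe_mk, this, ← hc]
      simp
  let E := LinearEquiv.ofBijective e he
  have hE (g : Γ) : (E : (X → V) →ₗ[k] _) ∘ₗ funRep φ σ g =
      Representation.coind S.subtype (σ.comp S.subtype) g ∘ₗ (E : (X → V) →ₗ[k] _) := by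
    refine LinearMap.ext fun F => Subtype.ext (funext fun h => ?_)
    change σ h (funRep φ σ g F ((φ h).symm x₀)) = σ (h * g) (F ((φ (h * g)).symm x₀))
    simp [funRep_apply, Equiv.Perm.mul_def]
  let i : Rep.of (funRep φ σ) ≅ Rep.coind S.subtype (Rep.of (σ.comp S.subtype)) :=
    Rep.mkIso (.mk E hE)
  exact ⟨(((groupCohomology.functor k Γ n).mapIso i ≪≫
    groupCohomology.coindIso (Rep.of (σ.comp S.subtype)) n).toLinearEquiv).toAddEquiv⟩

end Homological

/-! ### Functions on the line -/

theorem exists_sub_eq {V : Type} [AddCommGroup V] (h : ℤ → V) :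
    ∃ F : ℤ → V, ∀ n, F (n + 1) - F n = h n := by
  refine ⟨fun n => ∑ i ∈ Finset.Ico 0 n, h i - ∑ i ∈ Finset.Ico n 0, h i, fun n => ?_⟩
  beta_reduce
  rcases le_or_gt 0 n with hn | hn
  · have : Finset.Ico 0 (n + 1) = insert n (Finset.Ico 0 n) := by
      ext i
      simp only [Finset.mem_Ico, Finset.mem_insert]
      omega
    rw [this, Finset.sum_insert (by simp), Finset.Ico_eq_empty (by omega : ¬ n < 0),
      Finset.Ico_eq_empty (by omega : ¬ n + 1 < 0)]
    simp
  · have : Finset.Ico n 0 = insert n (Finset.Ico (n + 1) 0) := by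
      ext i
      simp only [Finset.mem_Ico, Finset.mem_insert]
      omega
    rw [this, Finset.sum_insert (by simp), Finset.Ico_eq_empty (by omega : ¬ 0 < n),
      Finset.Ico_eq_empty (by omega : ¬ 0 < n + 1)]
    simp

theorem eq_of_succ_eq {V : Type} {F : ℤ → V} (h : ∀ n, F (n + 1) = F n) (n : ℤ) : F n = F 0 := by
  induction n with
  | zero => rfl
  | succ n ih => rw [h, ih]
  | pred n ih => rw [← ih, ← h, sub_add_cancel]

/-! ### Crossed homomorphisms into `ℤ_η` -/

section Twisted

variable {Γ : Type} [Group Γ] (η : Γ →* ℤˣ)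

theorem twistedRep_apply (g : Γ) (n : ℤ) : twistedRep η g n = (η g : ℤ) * n := rfl

theorem subsingleton_H0_twistedInt {b : Γ} (hb : η b = -1) :
    Subsingleton (groupCohomology (twistedInt η) 0) := by
  have : Subsingleton (twistedInt η).ρ.invariants := by
    refine subsingleton_of_forall_eq 0 fun x => Subtype.ext ?_
    let n : ℤ := x.1
    have h : (η b : ℤ) * n = n := x.2 b
    rw [hb] at h
    change n = 0
    simp at h
    omega
  exact (groupCohomology.H0Iso (twistedInt η)).toLinearEquiv.toEquiv.subsingleton

/-- A crossed homomorphism `Γ → ℤ_η`. -/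
def IsCrossed (f : Γ → ℤ) : Prop := ∀ g h, f (g * h) = (η g : ℤ) * f h + f g

variable {η}

theorem IsCrossed.map_one {f : Γ → ℤ} (hf : IsCrossed η f) : f 1 = 0 := by
  have := hf 1 1
  simp at this
  exact this

/-- The elements on which a crossed homomorphism vanishes form a subgroup. -/
def IsCrossed.ker {f : Γ → ℤ} (hf : IsCrossed η f) : Subgroup Γ where
  carrier := {g | f g = 0}
  one_mem' := hf.map_one
  mul_mem' {g h} hg hh := by
    simp only [Set.mem_ofPred_eq] at *
    rw [hf, hg, hh, mul_zero, add_zero]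
  inv_mem' {g} hg := by
    simp only [Set.mem_ofPred_eq] at *
    have := hf g⁻¹ g
    rw [inv_mul_cancel, hf.map_one, hg] at this
    omega

theorem IsCrossed.mem_ker {f : Γ → ℤ} (hf : IsCrossed η f) {g : Γ} : g ∈ hf.ker ↔ f g = 0 :=
  Iff.rfl

/-- A crossed homomorphism which vanishes on `b` and on a conjugate of `b`, where `η b = -1`, also
vanishes on the conjugating element, since `2 f(g) = 0`. -/
theorem IsCrossed.mem_ker_of_conj {f : Γ → ℤ} (hf : IsCrossed η f) {g b : Γ} (hηb : η b = -1)
    (hb : b ∈ hf.ker) (hg : g * b * g⁻¹ ∈ hf.ker) : g ∈ hf.ker := by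
  rw [hf.mem_ker] at *
  have h := hf (g * b * g⁻¹) g
  have hη : η (g * b * g⁻¹) = -1 := by
    rw [map_mul, map_mul, map_inv, hηb, mul_right_comm, mul_inv_cancel, one_mul]
  rw [inv_mul_cancel_right, hf, hg, hb, hη] at h
  simp at h
  omega

/-- If a crossed homomorphism `Γ → ℤ_η` is determined by its value at one element `b` with
`η b = -1`, then `H¹(Γ, ℤ_η)` has order two: a class is determined by the parity of `f b`. -/
theorem natCard_H1_twistedInt {b : Γ} (hb : η b = -1)
    (hdet : ∀ f : Γ → ℤ, IsCrossed η f → f b = 0 → f = 0) :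
    Nat.card (groupCohomology (twistedInt η) 1) = 2 := by
  let v (f : groupCohomology.cocycles₁ (twistedInt η)) : Γ → ℤ := fun g => f g
  have hcr (f : groupCohomology.cocycles₁ (twistedInt η)) : IsCrossed η (v f) :=
    (groupCohomology.mem_cocycles₁_iff (A := twistedInt η) f).1 f.2
  let ev : groupCohomology.cocycles₁ (twistedInt η) →+ ZMod 2 :=
    { toFun f := (v f b : ZMod 2)
      map_zero' := Int.cast_zero
      map_add' f f' := Int.cast_add _ _ }
  have hev : Function.Surjective ev := by
    have hone : ∃ f, ev f = 1 := by
      -- `(η - 1) / 2` is a crossed homomorphism.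
      refine ⟨⟨fun g : Γ => show ℤ from if η g = 1 then 0 else 1,
        (groupCohomology.mem_cocycles₁_iff (A := twistedInt η) _).2 fun g h => ?_⟩, ?_⟩
      · change _ = (η g : ℤ) * _ + _
        rw [map_mul]
        rcases Int.units_eq_one_or (η g) with h₁ | h₁ <;>
        rcases Int.units_eq_one_or (η h) with h₂ | h₂ <;> rw [h₁, h₂] <;> decide
      · change (((if η b = 1 then (0 : ℤ) else 1) : ℤ) : ZMod 2) = 1
        rw [hb]
        decide
    obtain ⟨f, hf⟩ := hone
    intro c
    refine ⟨c.val • f, ?_⟩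
    rw [map_nsmul, hf]
    simp
  let π := (groupCohomology.H1π (twistedInt η)).hom.toAddMonoidHom
  have hπ : Function.Surjective π :=
    (ModuleCat.epi_iff_surjective (groupCohomology.H1π (twistedInt η))).1 inferInstance
  have hker : π.ker = ev.ker := by
    ext f
    rw [AddMonoidHom.mem_ker, AddMonoidHom.mem_ker]
    refine (groupCohomology.H1π_eq_zero_iff f).trans
      (Iff.trans ?_ (ZMod.intCast_zmod_eq_zero_iff_dvd (v f b) 2).symm)
    constructor
    · rintro ⟨x, hx⟩
      let n : ℤ := x
      have h : (η b : ℤ) * n - n = v f b := congr_fun hx b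
      rw [hb] at h
      refine ⟨-n, ?_⟩
      rw [← h]
      push_cast
      ring
    · rintro ⟨n, hn⟩
      have hn' : v f b = 2 * n := hn
      -- Subtracting a principal crossed homomorphism makes `f` vanish at `b`.
      have := hdet (fun g => v f g + ((η g : ℤ) * n - n)) (fun g h => by
        beta_reduce
        rw [hcr f g h, map_mul]
        push_cast
        ring) (by
          rw [hb, hn']
          push_cast
          ring)
      refine ⟨(-n : ℤ), funext fun g => ?_⟩
      have hg : v f g + ((η g : ℤ) * n - n) = 0 := congr_fun this g
      change (η g : ℤ) * (-n) - (-n) = v f g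
      linarith
  have e := (QuotientAddGroup.quotientKerEquivOfSurjective π hπ).symm.trans
    ((QuotientAddGroup.quotientAddEquivOfEq hker).trans
      (QuotientAddGroup.quotientKerEquivOfSurjective ev hev))
  exact (Nat.card_congr e.toEquiv).trans (Nat.card_zmod 2)

end Twisted

/-! ### Actions on the line by translations -/

section Wang

variable {k Γ V : Type} [CommRing k] [Group Γ] [AddCommGroup V] [Module k V]

/-- The action of `Γ` on `ℤ` by translations through `χ : Γ → ℤ`. -/
def translation (χ : Γ →* Multiplicative ℤ) : Γ →* Equiv.Perm ℤ :=
  (MulAction.toPermHom (Multiplicative ℤ) ℤ).comp χ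

theorem translation_apply (χ : Γ →* Multiplicative ℤ) (g : Γ) (n : ℤ) :
    translation χ g n = (χ g).toAdd + n := rfl

theorem translation_symm_apply (χ : Γ →* Multiplicative ℤ) (g : Γ) (n : ℤ) :
    (translation χ g).symm n = -(χ g).toAdd + n := by
  rw [Equiv.symm_apply_eq, translation_apply]
  ring

/-- The long exact sequence of `0 → V → (ℤ → V) → (ℤ → V) → 0` for the action of `Γ` on the line
by translations, the second map being the difference operator. -/
theorem exists_wang_sequence (χ : Γ →* Multiplicative ℤ) (σ : Representation k Γ V) :
    ∃ (φ : ∀ n, groupCohomology (Rep.of σ) n →+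
          groupCohomology (Rep.of (funRep (translation χ) σ)) n)
      (ψ : ∀ n, groupCohomology (Rep.of (funRep (translation χ) σ)) n →+
          groupCohomology (Rep.of (funRep (translation χ) σ)) n)
      (δ : ∀ n, groupCohomology (Rep.of (funRep (translation χ) σ)) n →+
          groupCohomology (Rep.of σ) (n + 1)),
      (∀ n, Function.Exact (φ n) (ψ n)) ∧ (∀ n, Function.Exact (ψ n) (δ n)) ∧
      ∀ n, Function.Exact (δ n) (φ (n + 1)) := by
  let f : Rep.of σ ⟶ Rep.of (funRep (translation χ) σ) :=
    Rep.ofHom ⟨LinearMap.pi fun _ => LinearMap.id, fun g => by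
      ext v n
      simp [funRep_apply]⟩
  let g : Rep.of (funRep (translation χ) σ) ⟶ Rep.of (funRep (translation χ) σ) :=
    Rep.ofHom ⟨LinearMap.funLeft k V (· + 1) - LinearMap.id, fun g => by
      refine LinearMap.ext fun F => funext fun n => ?_
      change funRep _ σ g F (n + 1) - funRep _ σ g F n = funRep _ σ g (fun n => F (n + 1) - F n) n
      simp only [funRep_apply, translation_symm_apply, map_sub, add_assoc]⟩
  refine exists_long_exact f g (fun v w h => congr_fun h 0) (fun F => ⟨fun h => ?_, ?_⟩)
    fun h => ?_
  · exact ⟨F 0, funext fun n => (eq_of_succ_eq (fun m => sub_eq_zero.1 (congr_fun h m)) n).symm⟩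
  · rintro ⟨v, rfl⟩
    exact funext fun n => sub_self v
  · obtain ⟨F, hF⟩ := exists_sub_eq h
    exact ⟨F, funext hF⟩

/-- Shapiro's lemma for the translation action on the line. -/
theorem nonempty_groupCohomology_funRep_translation {χ : Γ →* Multiplicative ℤ}
    (hχ : Function.Surjective χ) (σ : Representation k Γ V) (n : ℕ) :
    Nonempty (groupCohomology (Rep.of (funRep (translation χ) σ)) n ≃+
      groupCohomology (Rep.of (σ.comp χ.ker.subtype)) n) := by
  refine nonempty_groupCohomology_funRep _ σ 0 _ (fun g => ?_) (fun m => ?_) n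
  · rw [translation_apply, add_zero]
    rfl
  · obtain ⟨g, hg⟩ := hχ (Multiplicative.ofAdd m)
    exact ⟨g, by rw [translation_apply, hg, toAdd_ofAdd, add_zero]⟩

/-- An infinite cyclic group has cohomological dimension at most one. -/
theorem subsingleton_groupCohomology_of_bijective {χ : Γ →* Multiplicative ℤ}
    (hχ : Function.Bijective χ) (σ : Representation k Γ V) (n : ℕ) :
    Subsingleton (groupCohomology (Rep.of σ) (n + 2)) := by
  have : Subsingleton χ.ker := by
    rw [(MonoidHom.ker_eq_bot_iff χ).2 hχ.1]
    infer_instance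
  have hF (m : ℕ) :
      Subsingleton (groupCohomology (Rep.of (funRep (translation χ) σ)) (m + 1)) := by
    obtain ⟨e⟩ := nonempty_groupCohomology_funRep_translation hχ.2 σ (m + 1)
    have := ModuleCat.subsingleton_of_isZero
      (isZero_groupCohomology_succ_of_subsingleton (Rep.of (σ.comp χ.ker.subtype)) m)
    exact e.toEquiv.subsingleton
  obtain ⟨φ, ψ, δ, -, -, h⟩ := exists_wang_sequence χ σ
  have := hF n
  have := hF (n + 1)
  refine subsingleton_of_forall_eq 0 fun x => ?_
  obtain ⟨y, rfl⟩ := (h (n + 1) x).1 (Subsingleton.elim _ _)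
  rw [Subsingleton.elim y 0, map_zero]

end Wang

/-! ### Extensions of an infinite cyclic group by another -/

section Klein

variable {Γ : Type} [Group Γ] {η : Γ →* ℤˣ} {a b : Γ}

/-- If `⟨b⟩` is normalised by `a` and every element is uniquely of the form `a ^ m * b ^ n`, then
`a ^ m * b ^ n ↦ m` is a homomorphism. -/
theorem exists_hom_ker_eq_zpowers (hconj : a * b * a⁻¹ = b ∨ a * b * a⁻¹ = b⁻¹)
    (hgen : ∀ g : Γ, ∃ m n : ℤ, g = a ^ m * b ^ n)
    (hfree : ∀ m n : ℤ, a ^ m * b ^ n = 1 → m = 0 ∧ n = 0) :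
    ∃ χ : Γ →* Multiplicative ℤ, Function.Surjective χ ∧ χ.ker = Subgroup.zpowers b := by
  have hnorm (m : ℤ) : a ^ m * b * (a ^ m)⁻¹ ∈ Subgroup.zpowers b := by
    have key : a ∈ Subgroup.normalizer (Subgroup.zpowers b : Set Γ) := by
      rw [Subgroup.mem_normalizer_iff]
      intro h
      have hz (j : ℤ) : a * b ^ j * a⁻¹ ∈ Subgroup.zpowers b := by
        rw [← conj_zpow]
        rcases hconj with h | h <;> rw [h]
        · exact Subgroup.zpow_mem _ (Subgroup.mem_zpowers b) j
        · exact Subgroup.zpow_mem _ (inv_mem (Subgroup.mem_zpowers b)) j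
      constructor
      · rintro ⟨j, rfl⟩
        exact hz j
      · rintro ⟨j, hj⟩
        have hj' : a * h * a⁻¹ = b ^ j := hj.symm
        rcases hconj with h' | h'
        · refine ⟨j, ?_⟩
          have : a * b ^ j * a⁻¹ = a * h * a⁻¹ := by rw [← conj_zpow, h', hj']
          simpa using this
        · refine ⟨-j, ?_⟩
          have : a * b ^ (-j) * a⁻¹ = a * h * a⁻¹ := by
            rw [← conj_zpow, h', hj', inv_zpow, zpow_neg, inv_inv]
          simpa using this
    exact (Subgroup.mem_normalizer_iff.1 (Subgroup.zpow_mem _ key m) b).1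
      (Subgroup.mem_zpowers b)
  have huniq (m n m' n' : ℤ) (h : a ^ m * b ^ n = a ^ m' * b ^ n') : m = m' := by
    have : a ^ (m - m') * b ^ (n - n') = 1 := by
      rw [sub_eq_neg_add, zpow_add, zpow_sub, zpow_neg]
      rw [show (a ^ m')⁻¹ * a ^ m * (b ^ n * (b ^ n')⁻¹) =
        (a ^ m')⁻¹ * (a ^ m * b ^ n) * (b ^ n')⁻¹ by group, h]
      group
    exact sub_eq_zero.1 (hfree _ _ this).1
  have hmul (m n m' n' : ℤ) : ∃ n'' : ℤ, a ^ m * b ^ n * (a ^ m' * b ^ n') =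
      a ^ (m + m') * b ^ n'' := by
    obtain ⟨j, hj⟩ := hnorm (-m')
    have hj' : b ^ j = a ^ (-m') * b * (a ^ (-m'))⁻¹ := hj
    refine ⟨j * n + n', ?_⟩
    rw [zpow_add b, zpow_mul, hj', conj_zpow]
    group
  choose μ ν hμ using hgen
  let χ : Γ →* Multiplicative ℤ := MonoidHom.mk' (fun g => Multiplicative.ofAdd (μ g)) fun g h => by
    obtain ⟨n'', hn⟩ := hmul (μ g) (ν g) (μ h) (ν h)
    rw [← hμ, ← hμ, hμ (g * h)] at hn
    exact congr_arg Multiplicative.ofAdd (huniq _ _ _ _ hn)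
  refine ⟨χ, fun m => ⟨a ^ m.toAdd, ?_⟩, ?_⟩
  · have := hμ (a ^ m.toAdd)
    exact congr_arg Multiplicative.ofAdd
      (huniq m.toAdd 0 (μ _) (ν _) (by rw [zpow_zero, mul_one]; exact this)).symm
  · ext g
    rw [MonoidHom.mem_ker, Subgroup.mem_zpowers_iff]
    constructor
    · intro h
      have h' : μ g = 0 := congr_arg Multiplicative.toAdd h
      refine ⟨ν g, ?_⟩
      conv_rhs => rw [hμ g, h', zpow_zero, one_mul]
    · rintro ⟨j, rfl⟩
      have := hμ (b ^ j)
      exact congr_arg Multiplicative.ofAdd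
        (huniq 0 j (μ _) (ν _) (by rw [zpow_zero, one_mul]; exact this)).symm

/-- The cohomology with coefficients in `ℤ_η` of a group `⟨b⟩ ⋊ ⟨a⟩` (the fundamental group of a
torus or of a Klein bottle), where `η b = -1`. -/
theorem cohomology_of_zpow_mul_zpow (hconj : a * b * a⁻¹ = b ∨ a * b * a⁻¹ = b⁻¹)
    (hgen : ∀ g : Γ, ∃ m n : ℤ, g = a ^ m * b ^ n)
    (hfree : ∀ m n : ℤ, a ^ m * b ^ n = 1 → m = 0 ∧ n = 0) (hb : η b = -1) :
    Subsingleton (groupCohomology (twistedInt η) 0) ∧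
    Nat.card (groupCohomology (twistedInt η) 1) = 2 ∧
    Nat.card (groupCohomology (twistedInt η) 2) = 2 ∧
    Subsingleton (groupCohomology (twistedInt η) 3) := by
  obtain ⟨χ, hχ, hker⟩ := exists_hom_ker_eq_zpowers hconj hgen hfree
  have hH1 : Nat.card (groupCohomology (twistedInt η) 1) = 2 := by
    refine natCard_H1_twistedInt hb fun f hf hfb => ?_
    have hbk : b ∈ hf.ker := hfb
    have hak : a ∈ hf.ker := hf.mem_ker_of_conj hb hbk (by
      rcases hconj with h | h <;> rw [h]
      · exact hbk
      · exact inv_mem hbk)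
    funext g
    obtain ⟨m, n, rfl⟩ := hgen g
    exact mul_mem (zpow_mem hak m) (zpow_mem hbk n)
  -- The kernel of `χ` is infinite cyclic, generated by `b`.
  have hbmem : b ∈ χ.ker := by
    rw [hker]
    exact Subgroup.mem_zpowers b
  let b' : χ.ker := ⟨b, hbmem⟩
  have hb' : (η.comp χ.ker.subtype) b' = -1 := hb
  have hpow (g : χ.ker) : ∃ j : ℤ, b' ^ j = g := by
    obtain ⟨j, hj⟩ := hker.le g.2
    exact ⟨j, Subtype.ext hj⟩
  have hbij : Function.Bijective (zpowersHom χ.ker b') := by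
    refine ⟨(injective_iff_map_eq_one _).2 fun j hj => ?_, fun g => ?_⟩
    · have h : b ^ j.toAdd = 1 := congr_arg Subtype.val hj
      exact (hfree 0 j.toAdd (by rw [zpow_zero, one_mul, h])).2
    · obtain ⟨j, hj⟩ := hpow g
      exact ⟨Multiplicative.ofAdd j, hj⟩
  let ε := (MulEquiv.ofBijective _ hbij).symm
  have hN0 := subsingleton_H0_twistedInt (η.comp χ.ker.subtype) hb'
  have hN1 : Nat.card (groupCohomology (twistedInt (η.comp χ.ker.subtype)) 1) = 2 := by
    refine natCard_H1_twistedInt hb' fun f hf hfb => ?_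
    funext g
    obtain ⟨j, rfl⟩ := hpow g
    exact zpow_mem (K := hf.ker) hfb j
  have hN2 (n : ℕ) : Subsingleton (groupCohomology (twistedInt (η.comp χ.ker.subtype)) (n + 2)) :=
    subsingleton_groupCohomology_of_bijective (χ := ε.toMonoidHom) ε.bijective _ n
  have hF (n : ℕ) : Nonempty (groupCohomology (Rep.of (funRep (translation χ) (twistedRep η))) n ≃+
      groupCohomology (twistedInt (η.comp χ.ker.subtype)) n) :=
    nonempty_groupCohomology_funRep_translation hχ (twistedRep η) n
  have hF0 : Subsingleton (groupCohomology (Rep.of (funRep (translation χ) (twistedRep η))) 0) :=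
    (hF 0).some.toEquiv.subsingleton
  have hF1 : Nat.card (groupCohomology (Rep.of (funRep (translation χ) (twistedRep η))) 1) = 2 :=
    (Nat.card_congr (hF 1).some.toEquiv).trans hN1
  have hF2 (n : ℕ) :
      Subsingleton (groupCohomology (Rep.of (funRep (translation χ) (twistedRep η))) (n + 2)) :=
    have := hN2 n
    (hF (n + 2)).some.toEquiv.subsingleton
  obtain ⟨φ, ψ, δ, h₂, h₃, h₁⟩ := exists_wang_sequence χ (twistedRep η)
  refine ⟨subsingleton_H0_twistedInt η hb, hH1, ?_, ?_⟩
  · have hφ : Function.Injective (φ 1) := (injective_iff_map_eq_zero _).2 fun x hx => by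
      obtain ⟨y, rfl⟩ := (h₁ 0 x).1 hx
      rw [Subsingleton.elim y 0, map_zero]
    have : Finite (groupCohomology (Rep.of (funRep (translation χ) (twistedRep η))) 1) :=
      Nat.finite_of_card_ne_zero (by rw [hF1]; norm_num)
    have hφ' : Function.Surjective (φ 1) :=
      (hφ.bijective_of_nat_card_le (by rw [hF1]; exact hH1.ge)).2
    have hδ : Function.Bijective (δ 1) := by
      refine ⟨(injective_iff_map_eq_zero _).2 fun x hx => ?_, fun x => ?_⟩
      · obtain ⟨y, rfl⟩ := (h₃ 1 x).1 hx
        exact (h₂ 1 y).2 (hφ' y)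
      · have := hF2 0
        exact (h₁ 1 x).1 (Subsingleton.elim _ _)
    exact (Nat.card_congr (Equiv.ofBijective _ hδ)).symm.trans hF1
  · refine subsingleton_of_forall_eq 0 fun x => ?_
    have := hF2 0
    have := hF2 1
    obtain ⟨y, rfl⟩ := (h₁ 2 x).1 (Subsingleton.elim _ _)
    exact (congr_arg _ (Subsingleton.elim y 0)).trans (map_zero _)

end Klein

/-! ### Group-theoretic preliminaries -/

section Groups

variable {Γ : Type*} [Group Γ]

theorem exists_zpow_mul_zpow_of_mem_closure {x y g : Γ} (hxy : Commute x y)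
    (hg : g ∈ Subgroup.closure {x, y}) : ∃ m n : ℤ, g = x ^ m * y ^ n := by
  induction hg using Subgroup.closure_induction with
  | mem g hg =>
    rcases hg with rfl | rfl
    · exact ⟨1, 0, by simp⟩
    · exact ⟨0, 1, by simp⟩
  | one => exact ⟨0, 0, by simp⟩
  | mul g h _ _ hg hh =>
    obtain ⟨m, n, rfl⟩ := hg
    obtain ⟨m', n', rfl⟩ := hh
    refine ⟨m + m', n + n', ?_⟩
    rw [zpow_add, zpow_add, mul_assoc, ← mul_assoc (y ^ n),
      ((hxy.zpow_zpow m' n).eq).symm]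
    simp only [mul_assoc]
  | inv g _ hg =>
    obtain ⟨m, n, rfl⟩ := hg
    refine ⟨-m, -n, ?_⟩
    rw [mul_inv_rev, zpow_neg, zpow_neg, (hxy.zpow_zpow m n).inv_inv.eq]

/-- Change of generators in the abelian group spanned by `x` and `y`. -/
theorem zpow_mul_zpow_of_commute {x y : Γ} (hxy : Commute x y) (r s t u i j : ℤ) :
    (x ^ r * y ^ s) ^ i * (x ^ t * y ^ u) ^ j = x ^ (r * i + t * j) * y ^ (s * i + u * j) := by
  rw [(hxy.zpow_zpow r s).mul_zpow, (hxy.zpow_zpow t u).mul_zpow, ← zpow_mul, ← zpow_mul,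
    ← zpow_mul, ← zpow_mul, zpow_add, zpow_add, mul_assoc, ← mul_assoc (y ^ (s * i)),
    ← (hxy.zpow_zpow (t * j) (s * i)).eq]
  simp only [mul_assoc]

/-- Conjugation by `g` maps `⟨S⟩` into itself; that it is onto follows from `g² ∈ ⟨S⟩`. -/
theorem mem_normalizer_closure_of_sq_mem {S : Set Γ} {g : Γ}
    (hconj : ∀ x ∈ S, g * x * g⁻¹ ∈ Subgroup.closure S) (hsq : g ^ 2 ∈ Subgroup.closure S) :
    g ∈ Subgroup.normalizer (Subgroup.closure S : Set Γ) := by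
  have h (x : Γ) (hx : x ∈ Subgroup.closure S) : g * x * g⁻¹ ∈ Subgroup.closure S := by
    have : Subgroup.closure S ≤ (Subgroup.closure S).comap (MulAut.conj g).toMonoidHom :=
      (Subgroup.closure_le _).2 fun x hx => hconj x hx
    exact this hx
  refine Subgroup.mem_normalizer_iff.2 fun x => ⟨h x, fun hx => ?_⟩
  have := mul_mem (mul_mem (inv_mem hsq) (h _ hx)) hsq
  convert this using 1
  group

/-- In a group generated by two involutions, every element is a power of their product, or such a
power times one of the involutions. -/
theorem eq_zpow_or_eq_zpow_mul_of_involutions {x y : Γ} (hx : x * x = 1) (hy : y * y = 1)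
    (hgen : Subgroup.closure {x, y} = ⊤) (g : Γ) :
    ∃ k : ℤ, g = (y * x) ^ k ∨ g = (y * x) ^ k * x := by
  have hinv : (y * x)⁻¹ = x * y := by
    rw [mul_inv_rev, inv_eq_of_mul_eq_one_left hx, inv_eq_of_mul_eq_one_left hy]
  have hxk (k : ℤ) : x * (y * x) ^ k = (y * x) ^ (-k) * x := by
    have h : SemiconjBy x (y * x) (y * x)⁻¹ := by
      rw [SemiconjBy, hinv, mul_assoc]
    have := (h.zpow_right k).eq
    rwa [inv_zpow'] at this
  have hleft (z : Γ) (hz : z = x ∨ z = y) (h : Γ)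
      (hh : ∃ k : ℤ, h = (y * x) ^ k ∨ h = (y * x) ^ k * x) :
      ∃ k : ℤ, z * h = (y * x) ^ k ∨ z * h = (y * x) ^ k * x := by
    have hyx : y = (y * x) * x := by rw [mul_assoc, hx, mul_one]
    obtain ⟨k, rfl | rfl⟩ := hh <;> rcases hz with rfl | rfl
    · exact ⟨-k, .inr (hxk k)⟩
    · refine ⟨1 - k, .inr ?_⟩
      nth_rewrite 1 [hyx]
      rw [mul_assoc (z * x), hxk, ← mul_assoc, ← zpow_one_add, sub_eq_add_neg]
    · refine ⟨-k, .inl ?_⟩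
      rw [← mul_assoc, hxk, mul_assoc, hx, mul_one]
    · refine ⟨1 - k, .inl ?_⟩
      nth_rewrite 1 [hyx]
      rw [mul_assoc (z * x), ← mul_assoc x, hxk, mul_assoc _ x x, hx, mul_one, ← zpow_one_add,
        sub_eq_add_neg]
  have hg : g ∈ Subgroup.closure {x, y} := by simp [hgen]
  induction hg using Subgroup.closure_induction_left with
  | one => exact ⟨0, .inl (zpow_zero _).symm⟩
  | mul_left z hz h _ ih => exact hleft z hz h ih
  | inv_mul_cancel z hz h _ ih =>
    have : z⁻¹ = z := by
      rcases hz with rfl | rfl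
      exacts [inv_eq_of_mul_eq_one_left hx, inv_eq_of_mul_eq_one_left hy]
    rw [this]
    exact hleft z hz h ih

end Groups

/-! ### Groups satisfying the sapphire relations -/

section SapphireRelations

variable {Γ : Type*} [Group Γ] {a b c : Γ} {r s t u : ℤ}

theorem commute_sq_of_conj_inv (h : a * b * a⁻¹ = b⁻¹) : Commute (a ^ 2) b := by
  have h' : SemiconjBy a b b⁻¹ := by
    rw [SemiconjBy, ← h, inv_mul_cancel_right]
  have := h'.inv_right.mul_left h'
  rwa [inv_inv, ← sq] at this

/-- The torus generators `a², b` and `c², a^{2t} b^u` span the same subgroup, since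
`ru - st = ±1`. -/
theorem closure_torus_eq (hdet : (r * u - s * t) ^ 2 = 1) (h₁ : a * b * a⁻¹ = b⁻¹)
    (h₂ : c ^ 2 = a ^ (2 * r) * b ^ s) :
    Subgroup.closure {c ^ 2, a ^ (2 * t) * b ^ u} = Subgroup.closure {a ^ 2, b} := by
  have hcomm := commute_sq_of_conj_inv h₁
  have hz (m : ℤ) : a ^ (2 * m) = (a ^ 2) ^ m := by
    rw [zpow_mul]
    norm_cast
  rw [h₂, hz, hz]
  set A := a ^ 2
  apply le_antisymm
  · have hA : A ∈ Subgroup.closure {A, b} := Subgroup.subset_closure (by simp)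
    have hb : b ∈ Subgroup.closure {A, b} := Subgroup.subset_closure (by simp)
    rw [Subgroup.closure_le]
    rintro _ (rfl | rfl) <;> exact mul_mem (zpow_mem hA _) (zpow_mem hb _)
  · have hc : A ^ r * b ^ s ∈ Subgroup.closure {A ^ r * b ^ s, A ^ t * b ^ u} :=
      Subgroup.subset_closure (by simp)
    have hd : A ^ t * b ^ u ∈ Subgroup.closure {A ^ r * b ^ s, A ^ t * b ^ u} :=
      Subgroup.subset_closure (by simp)
    have key (i j : ℤ) := zpow_mul_zpow_of_commute hcomm r s t u i j
    rw [Subgroup.closure_le]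
    rintro _ (rfl | rfl)
    · have := key ((r * u - s * t) * u) (-(r * u - s * t) * s)
      rw [show r * ((r * u - s * t) * u) + t * (-(r * u - s * t) * s) = 1 by
          linear_combination hdet,
        show s * ((r * u - s * t) * u) + u * (-(r * u - s * t) * s) = 0 by ring,
        zpow_one, zpow_zero, mul_one] at this
      have hmem := mul_mem (zpow_mem hc ((r * u - s * t) * u)) (zpow_mem hd (-(r * u - s * t) * s))
      rwa [this] at hmem
    · have := key (-(r * u - s * t) * t) ((r * u - s * t) * r)
      rw [show r * (-(r * u - s * t) * t) + t * ((r * u - s * t) * r) = 0 by ring,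
        show s * (-(r * u - s * t) * t) + u * ((r * u - s * t) * r) = 1 by
          linear_combination hdet,
        zpow_one, zpow_zero, one_mul] at this
      have hmem := mul_mem (zpow_mem hc (-(r * u - s * t) * t)) (zpow_mem hd ((r * u - s * t) * r))
      rwa [this] at hmem

theorem normal_closure_torus (hdet : (r * u - s * t) ^ 2 = 1) (h₁ : a * b * a⁻¹ = b⁻¹)
    (h₂ : c ^ 2 = a ^ (2 * r) * b ^ s)
    (h₃ : c * (a ^ (2 * t) * b ^ u) * c⁻¹ = (a ^ (2 * t) * b ^ u)⁻¹)
    (hgen : Subgroup.closure {a, b, c} = ⊤) : (Subgroup.closure {a ^ 2, b}).Normal := by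
  rw [← Subgroup.normalizer_eq_top_iff, eq_top_iff, ← hgen, Subgroup.closure_le]
  have hA : a ^ 2 ∈ Subgroup.closure {a ^ 2, b} := Subgroup.subset_closure (by simp)
  have hb : b ∈ Subgroup.closure {a ^ 2, b} := Subgroup.subset_closure (by simp)
  rintro _ (rfl | rfl | rfl)
  · refine mem_normalizer_closure_of_sq_mem ?_ hA
    rintro _ (rfl | rfl)
    · rwa [(Commute.self_pow _ 2).eq, mul_inv_cancel_right]
    · rw [h₁]
      exact inv_mem hb
  · exact Subgroup.le_normalizer hb
  · rw [← closure_torus_eq hdet h₁ h₂]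
    refine mem_normalizer_closure_of_sq_mem ?_ (Subgroup.subset_closure (by simp))
    rintro _ (rfl | rfl)
    · rw [(Commute.self_pow _ 2).eq, mul_inv_cancel_right]
      exact Subgroup.subset_closure (by simp)
    · rw [h₃]
      exact inv_mem (Subgroup.subset_closure (by simp))

/-- Modulo the torus subgroup the group is generated by the two involutions `a` and `c`. -/
theorem exists_torus_mul_zpow (hdet : (r * u - s * t) ^ 2 = 1) (h₁ : a * b * a⁻¹ = b⁻¹)
    (h₂ : c ^ 2 = a ^ (2 * r) * b ^ s)
    (h₃ : c * (a ^ (2 * t) * b ^ u) * c⁻¹ = (a ^ (2 * t) * b ^ u)⁻¹)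
    (hgen : Subgroup.closure {a, b, c} = ⊤) (g : Γ) :
    ∃ τ ∈ Subgroup.closure {a ^ 2, b}, ∃ k : ℤ,
      g = τ * (c * a) ^ k ∨ g = τ * ((c * a) ^ k * a) := by
  have hN := normal_closure_torus hdet h₁ h₂ h₃ hgen
  set T := Subgroup.closure {a ^ 2, b} with hT
  have hA : a ^ 2 ∈ T := Subgroup.subset_closure (by simp)
  have hb : b ∈ T := Subgroup.subset_closure (by simp)
  have hc : c ^ 2 ∈ T := by
    rw [hT, ← closure_torus_eq (c := c) hdet h₁ h₂]
    exact Subgroup.subset_closure (by simp)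
  let π := QuotientGroup.mk' T
  have hπ (h : Γ) (hh : h ∈ T) : π h = 1 := (QuotientGroup.eq_one_iff h).2 hh
  have hQ : Subgroup.closure {π a, π c} = ⊤ := by
    rw [eq_top_iff, ← Subgroup.map_top_of_surjective π (QuotientGroup.mk'_surjective T), ← hgen,
      MonoidHom.map_closure, Subgroup.closure_le]
    rintro _ ⟨_, rfl | rfl | rfl, rfl⟩
    · exact Subgroup.subset_closure (by simp)
    · rw [hπ _ hb]
      exact one_mem _
    · exact Subgroup.subset_closure (by simp)
  obtain ⟨k, hk⟩ := eq_zpow_or_eq_zpow_mul_of_involutions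
    (by rw [← map_mul, ← sq, hπ _ hA]) (by rw [← map_mul, ← sq, hπ _ hc]) hQ (π g)
  rw [← map_mul, ← map_zpow, ← map_mul] at hk
  have key (h : Γ) (hh : π g = π h) : ∃ τ ∈ T, g = τ * h :=
    ⟨g * h⁻¹, (QuotientGroup.eq_one_iff (N := T) _).1
      (by change π (g * h⁻¹) = 1; rw [map_mul, map_inv, hh, mul_inv_cancel]), by simp⟩
  rcases hk with hk | hk
  · obtain ⟨τ, hτ, h⟩ := key _ hk
    exact ⟨τ, hτ, k, .inl h⟩
  · obtain ⟨τ, hτ, h⟩ := key _ hk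
    exact ⟨τ, hτ, k, .inr h⟩

end SapphireRelations

theorem zpow_addRight {A : Type*} [AddCommGroup A] (v : A) (n : ℤ) :
    (Equiv.addRight v : Equiv.Perm A) ^ n = Equiv.addRight (n • v) := by
  have hone (w : A) : (Equiv.addRight w : Equiv.Perm A) * Equiv.addRight v =
      Equiv.addRight (w + v) := by
    ext x
    simp [add_comm, add_left_comm]
  induction n with
  | zero =>
    ext x
    simp
  | succ n ih => rw [zpow_add_one, ih, hone, add_zsmul, one_zsmul]
  | pred n ih => rw [zpow_sub_one, ih, mul_inv_eq_iff_eq_mul, hone, sub_zsmul, one_zsmul,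
      neg_add_cancel_right]

/-! ### The actions of `G` on the line and on `ℤ²` -/

section Presentation

variable {r s t u : ℤ}

/-- The element `a₁` of `G`. -/
def a₁ (r s t u : ℤ) : G r s t u := PresentedGroup.of Gen.a₁

/-- The element `a₂` of `G`. -/
def a₂ (r s t u : ℤ) : G r s t u := PresentedGroup.of Gen.a₂

theorem a₁_conj_b₁ : a₁ r s t u * b₁ r s t u * (a₁ r s t u)⁻¹ = (b₁ r s t u)⁻¹ :=
  mul_inv_eq_one.1 (PresentedGroup.one_of_mem (rels := rels r s t u) (by simp [rels]))

theorem a₂_sq : a₂ r s t u ^ 2 = a₁ r s t u ^ (2 * r) * b₁ r s t u ^ s :=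
  mul_inv_eq_one.1 (PresentedGroup.one_of_mem (rels := rels r s t u)
    (x := FreeGroup.of Gen.a₂ ^ 2 * (FreeGroup.of Gen.a₁ ^ (2 * r) * FreeGroup.of Gen.b₁ ^ s)⁻¹)
    (by simp [rels]))

theorem a₂_conj : a₂ r s t u * (a₁ r s t u ^ (2 * t) * b₁ r s t u ^ u) * (a₂ r s t u)⁻¹ =
    (a₁ r s t u ^ (2 * t) * b₁ r s t u ^ u)⁻¹ := by
  have : a₂ r s t u * a₁ r s t u ^ (2 * t) * b₁ r s t u ^ u * (a₂ r s t u)⁻¹ =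
      b₁ r s t u ^ (-u) * a₁ r s t u ^ (-2 * t) :=
    mul_inv_eq_one.1 (PresentedGroup.one_of_mem (rels := rels r s t u)
      (x := (FreeGroup.of Gen.a₂ * FreeGroup.of Gen.a₁ ^ (2 * t) * FreeGroup.of Gen.b₁ ^ u *
        (FreeGroup.of Gen.a₂)⁻¹) *
        (FreeGroup.of Gen.b₁ ^ (-u) * FreeGroup.of Gen.a₁ ^ (-2 * t))⁻¹) (by simp [rels]))
  rw [← mul_assoc, this, mul_inv_rev, ← zpow_neg, ← zpow_neg, neg_mul]

theorem closure_generators : Subgroup.closure {a₁ r s t u, b₁ r s t u, a₂ r s t u} = ⊤ := by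
  rw [eq_top_iff, ← PresentedGroup.closure_range_of (rels r s t u)]
  apply Subgroup.closure_mono
  rintro _ ⟨_ | _ | _, rfl⟩
  exacts [.inl rfl, .inr (.inl rfl), .inr (.inr rfl)]

/-- The universal property of `G`. -/
theorem exists_hom {H : Type*} [Group H] {α β γ : H} (h₁ : α * β * α⁻¹ = β⁻¹)
    (h₂ : γ ^ 2 = α ^ (2 * r) * β ^ s)
    (h₃ : γ * (α ^ (2 * t) * β ^ u) * γ⁻¹ = (α ^ (2 * t) * β ^ u)⁻¹) :
    ∃ φ : G r s t u →* H, φ (a₁ r s t u) = α ∧ φ (b₁ r s t u) = β ∧ φ (a₂ r s t u) = γ := by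
  let f : Gen → H := fun x => match x with
    | .a₁ => α
    | .b₁ => β
    | .a₂ => γ
  have hf : ∀ x ∈ rels r s t u, FreeGroup.lift f x = 1 := by
    rintro _ (rfl | rfl | rfl) <;>
    simp only [map_mul, map_inv, map_zpow, map_pow, FreeGroup.lift_apply_of, f, mul_inv_eq_one]
    · exact h₁
    · exact h₂
    · rw [mul_assoc γ, h₃, mul_inv_rev, ← zpow_neg, ← zpow_neg, neg_mul]
  exact ⟨PresentedGroup.toGroup hf, PresentedGroup.toGroup.of hf, PresentedGroup.toGroup.of hf,
    PresentedGroup.toGroup.of hf⟩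

/-- The action of `G` on `ℤ` through the infinite dihedral group, in which `a₁` and `a₂` act as the
reflections `x ↦ p - x` and `x ↦ q - x`, and `b₁` acts trivially. -/
theorem exists_reflection_action (r s t u p q : ℤ) :
    ∃ φ : G r s t u →* Equiv.Perm ℤ, φ (a₁ r s t u) = Equiv.subLeft p ∧
      φ (b₁ r s t u) = 1 ∧ φ (a₂ r s t u) = Equiv.subLeft q := by
  have hsq (p : ℤ) : (Equiv.subLeft p : Equiv.Perm ℤ) ^ 2 = 1 := by
    ext x
    simp [sq]
  have hz (m : ℤ) : (Equiv.subLeft p : Equiv.Perm ℤ) ^ (2 * m) = 1 := by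
    rw [zpow_mul]
    norm_cast
    rw [hsq, one_zpow]
  apply exists_hom
  · simp
  · rw [hz, hsq, one_zpow, one_mul]
  · rw [hz, one_zpow]
    simp

theorem reflection_action_apply {p q : ℤ} {φ : G r s t u →* Equiv.Perm ℤ}
    (ha : φ (a₁ r s t u) = Equiv.subLeft p) (hb : φ (b₁ r s t u) = 1)
    (hc : φ (a₂ r s t u) = Equiv.subLeft q) {τ : G r s t u}
    (hτ : τ ∈ Subgroup.closure {a₁ r s t u ^ 2, b₁ r s t u}) (k x : ℤ) :
    φ (τ * (a₂ r s t u * a₁ r s t u) ^ k) x = x + k * (q - p) ∧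
    φ (τ * ((a₂ r s t u * a₁ r s t u) ^ k * a₁ r s t u)) x = p - x + k * (q - p) := by
  have hτ' : φ τ = 1 := by
    have : Subgroup.closure {a₁ r s t u ^ 2, b₁ r s t u} ≤ φ.ker := by
      rw [Subgroup.closure_le]
      rintro _ (rfl | rfl)
      · rw [SetLike.mem_coe, MonoidHom.mem_ker, map_pow, ha]
        ext x
        simp [sq]
      · exact hb
    exact this hτ
  have hca : φ (a₂ r s t u * a₁ r s t u) = Equiv.addRight (q - p) := by
    ext x
    simp [ha, hc]
    ring
  have hk : φ ((a₂ r s t u * a₁ r s t u) ^ k) = Equiv.addRight (k * (q - p)) := by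
    rw [map_zpow, hca, zpow_addRight, smul_eq_mul]
  constructor
  · rw [map_mul, hτ', hk]
    rfl
  · rw [map_mul, hτ', map_mul, hk, ha]
    rfl

/-- `a₁²` and `b₁` generate a free abelian group of rank two in `G`: `G` acts on `ℤ²` by affine maps
so that `a₁²` and `b₁` are the translations by `(2, 0)` and `(0, 2)`. The generator `a₁` acts as a
glide reflection along `(1, 0)`, and `a₂` as the glide reflection along `(r, s)` which reverses the
direction `(t, u)`. -/
theorem torus_free (hdet : (r * u - s * t) ^ 2 = 1) (m n : ℤ)
    (h : (a₁ r s t u ^ 2) ^ m * b₁ r s t u ^ n = 1) : m = 0 ∧ n = 0 := by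
  let α : Equiv.Perm (ℤ × ℤ) :=
    { toFun v := (v.1 + 1, -v.2)
      invFun v := (v.1 - 1, -v.2)
      left_inv v := by simp
      right_inv v := by simp }
  let d := r * u - s * t
  -- `R` is the linear involution fixing `(r, s)` and negating `(t, u)`: the coordinate of `v` along
  -- `(t, u)` is `d * (r * v.2 - s * v.1)`, as `d = ±1`.
  let R : ℤ × ℤ → ℤ × ℤ := fun v => (v.1 - 2 * d * t * (r * v.2 - s * v.1),
    v.2 - 2 * d * u * (r * v.2 - s * v.1))
  have hR (v : ℤ × ℤ) : R (R v) = v := by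
    ext <;> simp only [R, d]
    · linear_combination (4 * (r * u - s * t) * t * (r * v.2 - s * v.1)) * hdet
    · linear_combination (4 * (r * u - s * t) * u * (r * v.2 - s * v.1)) * hdet
  let γ : Equiv.Perm (ℤ × ℤ) :=
    { toFun v := R v + (r, s)
      invFun v := R (v - (r, s))
      left_inv v := by simp [hR]
      right_inv v := by simp [hR] }
  let β : Equiv.Perm (ℤ × ℤ) := Equiv.addRight (0, 2)
  have hα : α ^ 2 = Equiv.addRight (2, 0) := by
    ext v <;> simp [sq, α, add_assoc]
  have hz (m : ℤ) : α ^ (2 * m) = Equiv.addRight (m • (2, 0)) := by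
    rw [zpow_mul]
    norm_cast
    rw [hα, zpow_addRight]
  have hβ (n : ℤ) : β ^ n = Equiv.addRight (n • (0, 2)) := zpow_addRight _ _
  have hτ (m n : ℤ) : α ^ (2 * m) * β ^ n = Equiv.addRight (2 * m, 2 * n) := by
    rw [hz, hβ]
    ext v <;> simp [mul_comm]
  obtain ⟨φ, ha, hb, -⟩ : ∃ φ : G r s t u →* Equiv.Perm (ℤ × ℤ), φ (a₁ r s t u) = α ∧
      φ (b₁ r s t u) = β ∧ φ (a₂ r s t u) = γ := by
    refine exists_hom ?_ ?_ ?_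
    · rw [mul_inv_eq_iff_eq_mul, eq_inv_mul_iff_mul_eq]
      ext v <;> simp [α, β]
    · rw [hτ]
      ext v <;> simp only [sq, Equiv.Perm.mul_apply, γ, R, d, Equiv.coe_fn_mk, Prod.fst_add,
        Prod.snd_add, Equiv.coe_addRight]
      · linear_combination (4 * (r * u - s * t) * t * (r * v.2 - s * v.1)) * hdet
      · linear_combination (4 * (r * u - s * t) * u * (r * v.2 - s * v.1)) * hdet
    · rw [hτ, mul_inv_eq_iff_eq_mul, eq_inv_mul_iff_mul_eq]
      ext v <;> simp only [Equiv.Perm.mul_apply, γ, R, d, Equiv.coe_fn_mk, Prod.fst_add,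
        Prod.snd_add, Equiv.coe_addRight]
      · linear_combination (-4 * t) * hdet
      · linear_combination (-4 * u) * hdet
  have h' := congr_arg φ h
  rw [map_mul, map_zpow, map_zpow, map_pow, ha, hb, map_one] at h'
  have h2 : α ^ (2 * m) * β ^ n = 1 := by
    rw [zpow_mul]
    exact_mod_cast h'
  rw [hτ] at h2
  have h3 := congr_arg (fun e : Equiv.Perm (ℤ × ℤ) => e (0, 0)) h2
  simpa using h3

end Presentation

/-! ### The exact sequence of the line and the Bockstein sequence -/

section Tree

variable {k Γ V : Type} [CommRing k] [Group Γ] [AddCommGroup V] [Module k V]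

/-- The long exact sequence for an action on the line without inversions. The edge `e` joins `e`
and `e + 1`; even vertices `2 * j` and odd vertices `2 * j + 1` are both indexed by `j`, so that the
even end of `e` is `(e + 1) / 2` and the odd end is `e / 2`. The sequence comes from
`0 → V → (even vertices → V) × (odd vertices → V) → (edges → V) → 0`. -/
theorem exists_line_sequence {φ₀ φ₁ φE : Γ →* Equiv.Perm ℤ}
    (h₀ : ∀ g e, (φE g e + 1) / 2 = φ₀ g ((e + 1) / 2)) (h₁ : ∀ g e, φE g e / 2 = φ₁ g (e / 2))
    (σ : Representation k Γ V) :
    ∃ (φ : ∀ n, groupCohomology (Rep.of σ) n →+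
          groupCohomology (Rep.of ((funRep φ₀ σ).prod (funRep φ₁ σ))) n)
      (ψ : ∀ n, groupCohomology (Rep.of ((funRep φ₀ σ).prod (funRep φ₁ σ))) n →+
          groupCohomology (Rep.of (funRep φE σ)) n)
      (δ : ∀ n, groupCohomology (Rep.of (funRep φE σ)) n →+
          groupCohomology (Rep.of σ) (n + 1)),
      (∀ n, Function.Exact (φ n) (ψ n)) ∧ (∀ n, Function.Exact (ψ n) (δ n)) ∧
      ∀ n, Function.Exact (δ n) (φ (n + 1)) := by
  have h₀' (g e) : (φ₀ g).symm ((e + 1) / 2) = ((φE g).symm e + 1) / 2 := by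
    rw [Equiv.symm_apply_eq, ← h₀, Equiv.apply_symm_apply]
  have h₁' (g e) : (φ₁ g).symm (e / 2) = (φE g).symm e / 2 := by
    rw [Equiv.symm_apply_eq, ← h₁, Equiv.apply_symm_apply]
  let f : Rep.of σ ⟶ Rep.of ((funRep φ₀ σ).prod (funRep φ₁ σ)) :=
    Rep.ofHom ⟨(LinearMap.pi fun _ => LinearMap.id).prod (LinearMap.pi fun _ => LinearMap.id),
      fun g => by
        ext v n <;> simp [funRep_apply]⟩
  let g : Rep.of ((funRep φ₀ σ).prod (funRep φ₁ σ)) ⟶ Rep.of (funRep φE σ) :=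
    Rep.ofHom ⟨LinearMap.funLeft k V (· / 2) ∘ₗ LinearMap.snd k (ℤ → V) (ℤ → V) -
        LinearMap.funLeft k V (fun e => (e + 1) / 2) ∘ₗ LinearMap.fst k (ℤ → V) (ℤ → V),
      fun g => by
        refine LinearMap.ext fun F => funext fun e => ?_
        change funRep φ₁ σ g F.2 (e / 2) - funRep φ₀ σ g F.1 ((e + 1) / 2) =
          funRep φE σ g (fun e => F.2 (e / 2) - F.1 ((e + 1) / 2)) e
        simp only [funRep_apply, h₀', h₁', map_sub]⟩
  have hg (F₀ F₁ : ℤ → V) (e : ℤ) : g.hom (F₀, F₁) e = F₁ (e / 2) - F₀ ((e + 1) / 2) := rfl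
  have e₁ (j : ℤ) : 2 * j / 2 = j := by omega
  have e₂ (j : ℤ) : (2 * j + 1) / 2 = j := by omega
  have e₃ (j : ℤ) : (2 * j + 1 + 1) / 2 = j + 1 := by omega
  refine exists_long_exact f g (fun v w h => congr_fun (congr_arg Prod.fst h) 0)
    (fun F => ⟨fun h => ?_, ?_⟩) fun h => ?_
  · obtain ⟨F₀, F₁⟩ := F
    have ha (j : ℤ) : F₁ j = F₀ j := by
      have := congr_fun h (2 * j)
      rw [hg, e₁, e₂] at this
      exact sub_eq_zero.1 this
    have hb (j : ℤ) : F₁ j = F₀ (j + 1) := by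
      have := congr_fun h (2 * j + 1)
      rw [hg, e₂, e₃] at this
      exact sub_eq_zero.1 this
    have hc (j : ℤ) : F₀ j = F₀ 0 := eq_of_succ_eq (fun m => by rw [← hb, ha]) j
    exact ⟨F₀ 0, Prod.ext (funext fun j => (hc j).symm)
      (funext fun j => ((ha j).trans (hc j)).symm)⟩
  · rintro ⟨v, rfl⟩
    exact funext fun n => sub_self v
  · obtain ⟨F, hF⟩ := exists_sub_eq fun j => h (2 * j) - h (2 * j + 1)
    refine ⟨(F, fun j => F j + h (2 * j)), funext fun e => ?_⟩
    rw [hg]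
    obtain ⟨j, rfl | rfl⟩ := e.even_or_odd'
    · rw [e₁, e₂, add_sub_cancel_left]
    · rw [e₂, e₃, ← sub_add_cancel (F (j + 1)) (F j), hF]
      abel

/-- The Bockstein sequence of `0 → ℤ_η → ℤ_η → ℤ/2 → 0`. -/
theorem exists_bockstein_exact (η : Γ →* ℤˣ) :
    ∃ (ψ : groupCohomology (twistedInt η) 1 →+ groupCohomology (Rep.trivial ℤ Γ (ZMod 2)) 1)
      (δ : groupCohomology (Rep.trivial ℤ Γ (ZMod 2)) 1 →+ groupCohomology (twistedInt η) 2),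
      Function.Exact ψ δ := by
  let f : Rep.of (twistedRep η) ⟶ Rep.of (twistedRep η) :=
    Rep.ofHom ⟨2 • LinearMap.id, fun g => by
      ext
      simp [twistedRep_apply, mul_comm]⟩
  let g : Rep.of (twistedRep η) ⟶ Rep.trivial ℤ Γ (ZMod 2) :=
    Rep.ofHom ⟨(Int.castAddHom (ZMod 2)).toIntLinearMap, fun g => by
      ext
      rcases Int.units_eq_one_or (η g) with h | h <;> simp [twistedRep_apply, h]⟩
  have hf (n : ℤ) : f.hom n = 2 * n := by
    simp [f]
  have hg (n : ℤ) : g.hom n = (n : ZMod 2) := rfl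
  obtain ⟨φ, ψ, δ, -, h, -⟩ := exists_long_exact f g
    (fun m n h => by
      rw [hf, hf] at h
      exact mul_left_cancel₀ two_ne_zero h)
    (fun n => by
      rw [hg, ZMod.intCast_zmod_eq_zero_iff_dvd]
      exact ⟨fun ⟨m, hm⟩ => ⟨m, (hf m).trans hm.symm⟩, fun ⟨m, hm⟩ => ⟨m, hm.symm.trans (hf m)⟩⟩)
    (fun c => ZMod.intCast_surjective (n := 2) c)
  exact ⟨ψ 1, δ 1, h 1⟩

end Tree

theorem nonempty_addEquiv_zmod_two {A : Type*} [AddGroup A] (h : Nat.card A = 2) :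
    Nonempty (A ≃+ ZMod 2) :=
  ⟨addEquivOfPrimeCardEq (p := 2) h (Nat.card_zmod 2)⟩

/-! ### The stabilisers and the group `G` -/

section Stabilisers

variable {r s t u : ℤ} {η : G r s t u →* ℤˣ}

/-- A homomorphism of `G` into `{1, -1}` which is `-1` on `b₁` forces `s` to be even, by the second
relation. -/
theorem even_of_map_b₁ (hη : η (b₁ r s t u) = -1) : Even s := by
  have h := congr_arg η (a₂_sq (r := r) (s := s) (t := t) (u := u))
  have hsq (x : ℤˣ) : x ^ 2 = 1 := Int.units_sq x
  rw [map_mul, map_pow, map_zpow, map_zpow, hη, hsq, zpow_mul,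
    show η (a₁ r s t u) ^ (2 : ℤ) = 1 from hsq _, one_zpow, one_mul] at h
  by_contra hs
  rw [(Int.not_even_iff_odd.1 hs).neg_one_zpow] at h
  exact absurd h (by decide)

/-- `η` is also `-1` on the second fibre generator `a₁^{2t} b₁^u`: as `s` is even, `u` is odd. -/
theorem map_torus (hη : η (b₁ r s t u) = -1) (hdet : (r * u - s * t) ^ 2 = 1) :
    η (a₁ r s t u ^ (2 * t) * b₁ r s t u ^ u) = -1 := by
  have hu : Odd u := by
    by_contra hu
    obtain ⟨i, hi⟩ := even_of_map_b₁ hη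
    obtain ⟨j, hj⟩ := Int.not_odd_iff_even.1 hu
    have : (2 : ℤ) ∣ 1 := ⟨2 * (r * j - i * t) ^ 2, by rw [← hdet, hi, hj]; ring⟩
    omega
  rw [map_mul, map_zpow, map_zpow, hη, zpow_mul,
    show η (a₁ r s t u) ^ (2 : ℤ) = 1 from Int.units_sq _, one_zpow, one_mul, hu.neg_one_zpow]

theorem commute_a₁_sq_b₁ : Commute (a₁ r s t u ^ 2) (b₁ r s t u) :=
  commute_sq_of_conj_inv a₁_conj_b₁

/-- The cohomology of a subgroup `S` of `G` of the form `⟨y⟩ ⋊ ⟨x⟩`. -/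
theorem cohomology_subgroup (S : Subgroup (G r s t u)) {x y : G r s t u} (hx : x ∈ S) (hy : y ∈ S)
    (hconj : x * y * x⁻¹ = y ∨ x * y * x⁻¹ = y⁻¹)
    (hgen : ∀ g ∈ S, ∃ m n : ℤ, g = x ^ m * y ^ n)
    (hfree : ∀ m n : ℤ, x ^ m * y ^ n = 1 → m = 0 ∧ n = 0) (hηy : η y = -1) :
    Subsingleton (groupCohomology (twistedInt (η.comp S.subtype)) 0) ∧
    Nat.card (groupCohomology (twistedInt (η.comp S.subtype)) 1) = 2 ∧
    Nat.card (groupCohomology (twistedInt (η.comp S.subtype)) 2) = 2 ∧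
    Subsingleton (groupCohomology (twistedInt (η.comp S.subtype)) 3) := by
  refine cohomology_of_zpow_mul_zpow (a := ⟨x, hx⟩) (b := ⟨y, hy⟩) ?_ (fun g => ?_)
    (fun m n h => hfree m n (congr_arg Subtype.val h)) hηy
  · exact hconj.imp (fun h => Subtype.ext h) fun h => Subtype.ext h
  · obtain ⟨m, n, h⟩ := hgen g g.2
    exact ⟨m, n, Subtype.ext h⟩

/-- `G` has three independent homomorphisms to `ℤ/2`, which gives four independent classes in
`H²(G, ℤ_η)`. -/
theorem four_le_natCard_H2 (hη : η (b₁ r s t u) = -1)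
    (hH1 : Nat.card (groupCohomology (twistedInt η) 1) = 2)
    [Finite (groupCohomology (twistedInt η) 2)] :
    4 ≤ Nat.card (groupCohomology (twistedInt η) 2) := by
  obtain ⟨ψ, δ, hψδ⟩ := exists_bockstein_exact η
  let X := groupCohomology (Rep.trivial ℤ (G r s t u) (ZMod 2)) 1
  let ε : X ≃+ (Additive (G r s t u) →+ ZMod 2) :=
    (groupCohomology.H1IsoOfIsTrivial
      (Rep.trivial ℤ (G r s t u) (ZMod 2))).toLinearEquiv.toAddEquiv
  obtain ⟨j, hj⟩ : ∃ j : ZMod 2 × ZMod 2 × ZMod 2 → X, Function.Injective j := by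
    have hex (w : ZMod 2 × ZMod 2 × ZMod 2) : ∃ φ : G r s t u →* Multiplicative (ZMod 2),
        φ (a₁ r s t u) = .ofAdd w.1 ∧ φ (b₁ r s t u) = .ofAdd w.2.1 ∧
        φ (a₂ r s t u) = .ofAdd w.2.2 := by
      have hsq (x : Multiplicative (ZMod 2)) : x ^ 2 = 1 := by
        revert x
        decide
      have hz (x : Multiplicative (ZMod 2)) (m : ℤ) : x ^ (2 * m) = 1 := by
        rw [zpow_mul]
        norm_cast
        rw [hsq, one_zpow]
      have hinv (x : Multiplicative (ZMod 2)) : x⁻¹ = x :=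
        inv_eq_of_mul_eq_one_left (by rw [← sq, hsq])
      obtain ⟨i, rfl⟩ := even_of_map_b₁ hη
      refine exists_hom ?_ ?_ ?_
      · rw [mul_inv_cancel_comm, hinv]
      · rw [hsq, hz, one_mul, ← two_mul, hz]
      · rw [mul_inv_cancel_comm, hinv]
    choose φ h₁ h₂ h₃ using hex
    refine ⟨fun w => ε.symm (MonoidHom.toAdditiveLeft (φ w)), fun w w' h => ?_⟩
    have h' : φ w = φ w' := MonoidHom.toAdditiveLeft.injective (ε.symm.injective h)
    refine Prod.ext ?_ (Prod.ext ?_ ?_)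
    · exact Multiplicative.ofAdd.injective (by rw [← h₁, ← h₁, h'])
    · exact Multiplicative.ofAdd.injective (by rw [← h₂, ← h₂, h'])
    · exact Multiplicative.ofAdd.injective (by rw [← h₃, ← h₃, h'])
  -- `X` has at least eight elements, and the kernel of `X → H²` is a quotient of `H¹`.
  have : Finite (groupCohomology (twistedInt η) 1) :=
    Nat.finite_of_card_ne_zero (by rw [hH1]; norm_num)
  have hker : δ.ker = ψ.range := AddSubgroup.ext fun x => hψδ x
  have : Finite δ.ker := by
    rw [hker]
    exact Finite.of_surjective _ ψ.rangeRestrict_surjective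
  have hker_card : Nat.card δ.ker ≤ 2 := by
    rw [hker]
    exact (Nat.card_le_card_of_surjective _ ψ.rangeRestrict_surjective).trans hH1.le
  have hX : Nat.card X = Nat.card δ.range * Nat.card δ.ker := by
    rw [AddSubgroup.card_eq_card_quotient_mul_card_addSubgroup δ.ker,
      Nat.card_congr (QuotientAddGroup.quotientKerEquivRange δ).toEquiv]
  have : Finite X := Nat.finite_of_card_ne_zero (by
    rw [hX]
    exact mul_ne_zero Nat.card_pos.ne' Nat.card_pos.ne')
  have h8 : 8 ≤ Nat.card X := by
    have := Nat.card_le_card_of_injective j hj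
    simpa [Nat.card_prod] using this
  have hr : Nat.card δ.range ≤ Nat.card (groupCohomology (twistedInt η) 2) :=
    Nat.card_le_card_of_injective _ Subtype.val_injective
  rw [hX] at h8
  by_contra hlt
  have : Nat.card δ.range * Nat.card δ.ker ≤ 3 * 2 := Nat.mul_le_mul (by omega) hker_card
  omega

/-- The stabiliser of an even vertex of the line is the Klein bottle group `⟨a₁, b₁⟩`. -/
theorem cohomology_even_vertex (hdet : (r * u - s * t) ^ 2 = 1) (hη : η (b₁ r s t u) = -1)
    {φ : G r s t u →* Equiv.Perm ℤ} (ha : φ (a₁ r s t u) = Equiv.subLeft 0)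
    (hb : φ (b₁ r s t u) = 1) (hc : φ (a₂ r s t u) = Equiv.subLeft 1) (S : Subgroup (G r s t u))
    (hS : ∀ g, g ∈ S ↔ φ g 0 = 0) :
    Nat.card (groupCohomology (twistedInt (η.comp S.subtype)) 1) = 2 ∧
    Nat.card (groupCohomology (twistedInt (η.comp S.subtype)) 2) = 2 ∧
    Subsingleton (groupCohomology (twistedInt (η.comp S.subtype)) 3) := by
  refine (cohomology_subgroup (x := a₁ r s t u) S ((hS _).2 (by simp [ha]))
    ((hS _).2 (by simp [hb])) (.inr a₁_conj_b₁) (fun g hg => ?_) (fun m n h => ?_) hη).2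
  · have hT := normal_closure_torus hdet a₁_conj_b₁ a₂_sq a₂_conj closure_generators
    obtain ⟨τ, hτ, k, hk⟩ :=
      exists_torus_mul_zpow hdet a₁_conj_b₁ a₂_sq a₂_conj closure_generators g
    have hact := reflection_action_apply ha hb hc hτ k 0
    rw [hS] at hg
    rcases hk with rfl | rfl
    · obtain rfl : k = 0 := by linarith [hact.1]
      obtain ⟨m, n, h⟩ := exists_zpow_mul_zpow_of_mem_closure commute_a₁_sq_b₁ hτ
      exact ⟨2 * m, n, by rw [zpow_zero, mul_one, h, zpow_mul]; norm_cast⟩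
    · obtain rfl : k = 0 := by linarith [hact.2]
      obtain ⟨m, n, h⟩ := exists_zpow_mul_zpow_of_mem_closure commute_a₁_sq_b₁
        (hT.conj_mem _ hτ (a₁ r s t u)⁻¹)
      refine ⟨1 + 2 * m, n, ?_⟩
      rw [zpow_add, zpow_mul, show a₁ r s t u ^ (2 : ℤ) = a₁ r s t u ^ 2 by norm_cast,
        mul_assoc, ← h]
      group
  -- Squaring reduces the claim to `torus_free`.
  · have h' : a₁ r s t u ^ m = (b₁ r s t u ^ n)⁻¹ := eq_inv_of_mul_eq_one_left h
    have := torus_free hdet m (2 * n) (by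
      rw [← zpow_natCast, zpow_comm, h']
      group)
    omega

/-- The stabiliser of an odd vertex of the line is the Klein bottle group generated by `a₂` and
`a₁^{2t} b₁^u`. -/
theorem cohomology_odd_vertex (hdet : (r * u - s * t) ^ 2 = 1) (hη : η (b₁ r s t u) = -1)
    {φ : G r s t u →* Equiv.Perm ℤ} (ha : φ (a₁ r s t u) = Equiv.subLeft (-1))
    (hb : φ (b₁ r s t u) = 1) (hc : φ (a₂ r s t u) = Equiv.subLeft 0) (S : Subgroup (G r s t u))
    (hS : ∀ g, g ∈ S ↔ φ g 0 = 0) :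
    Nat.card (groupCohomology (twistedInt (η.comp S.subtype)) 1) = 2 ∧
    Nat.card (groupCohomology (twistedInt (η.comp S.subtype)) 2) = 2 ∧
    Subsingleton (groupCohomology (twistedInt (η.comp S.subtype)) 3) := by
  set d := a₁ r s t u ^ (2 * t) * b₁ r s t u ^ u with hd
  have hcl := closure_torus_eq (c := a₂ r s t u) hdet a₁_conj_b₁ a₂_sq
  have hcomm : Commute (a₂ r s t u ^ 2) d := commute_sq_of_conj_inv a₂_conj
  have hmem {τ : G r s t u} (hτ : τ ∈ Subgroup.closure {a₁ r s t u ^ 2, b₁ r s t u}) :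
      τ ∈ S := by
    have := (reflection_action_apply ha hb hc hτ 0 0).1
    rw [hS]
    simpa using this
  refine (cohomology_subgroup (x := a₂ r s t u) (y := d) S ((hS _).2 (by simp [hc]))
    (hmem (hcl ▸ Subgroup.subset_closure (.inr rfl))) (.inr a₂_conj) (fun g hg => ?_)
    (fun m n h => ?_) (map_torus hη hdet)).2
  · have hT := normal_closure_torus hdet a₁_conj_b₁ a₂_sq a₂_conj closure_generators
    obtain ⟨τ, hτ, k, hk⟩ :=
      exists_torus_mul_zpow hdet a₁_conj_b₁ a₂_sq a₂_conj closure_generators g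
    have hact := reflection_action_apply ha hb hc hτ k 0
    rw [hS] at hg
    rcases hk with rfl | rfl
    · obtain rfl : k = 0 := by linarith [hact.1]
      rw [← hcl] at hτ
      obtain ⟨m, n, h⟩ := exists_zpow_mul_zpow_of_mem_closure hcomm hτ
      exact ⟨2 * m, n, by rw [zpow_zero, mul_one, h, zpow_mul]; norm_cast⟩
    · obtain rfl : k = 1 := by linarith [hact.2]
      have hA : a₁ r s t u ^ 2 ∈ Subgroup.closure {a₁ r s t u ^ 2, b₁ r s t u} :=
        Subgroup.subset_closure (by simp)
      have hτ' := mul_mem (hT.conj_mem _ hτ (a₂ r s t u)⁻¹) hA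
      rw [← hcl] at hτ'
      obtain ⟨m, n, h⟩ := exists_zpow_mul_zpow_of_mem_closure hcomm hτ'
      refine ⟨1 + 2 * m, n, ?_⟩
      rw [zpow_add, zpow_mul, show a₂ r s t u ^ (2 : ℤ) = a₂ r s t u ^ 2 by norm_cast,
        mul_assoc, ← h, sq (a₁ r s t u)]
      group
  -- Squaring reduces the claim to `torus_free`, up to a change of basis of determinant `±1`.
  · have h' : a₂ r s t u ^ m = (d ^ n)⁻¹ := eq_inv_of_mul_eq_one_left h
    have h2 : (a₂ r s t u ^ 2) ^ m * d ^ (2 * n) = 1 := by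
      rw [← zpow_natCast, zpow_comm, h']
      group
    have hz : a₁ r s t u ^ (2 : ℤ) = a₁ r s t u ^ 2 := by norm_cast
    rw [a₂_sq, hd, zpow_mul _ 2 r, zpow_mul _ 2 t, hz,
      zpow_mul_zpow_of_commute commute_a₁_sq_b₁] at h2
    obtain ⟨e₁, e₂⟩ := torus_free hdet _ _ h2
    have hm : m = 0 := by
      linear_combination (r * u - s * t) * u * e₁ - (r * u - s * t) * t * e₂ - m * hdet
    have hn : 2 * n = 0 := by
      linear_combination (r * u - s * t) * r * e₂ - (r * u - s * t) * s * e₁ - 2 * n * hdet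
    exact ⟨hm, by omega⟩

/-- The stabiliser of an edge of the line is the torus group `⟨a₁², b₁⟩`. -/
theorem cohomology_edge (hdet : (r * u - s * t) ^ 2 = 1) (hη : η (b₁ r s t u) = -1)
    {φ : G r s t u →* Equiv.Perm ℤ} (ha : φ (a₁ r s t u) = Equiv.subLeft (-1))
    (hb : φ (b₁ r s t u) = 1) (hc : φ (a₂ r s t u) = Equiv.subLeft 1) (S : Subgroup (G r s t u))
    (hS : ∀ g, g ∈ S ↔ φ g 0 = 0) :
    Subsingleton (groupCohomology (twistedInt (η.comp S.subtype)) 0) ∧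
    Nat.card (groupCohomology (twistedInt (η.comp S.subtype)) 1) = 2 ∧
    Nat.card (groupCohomology (twistedInt (η.comp S.subtype)) 2) = 2 := by
  have hAb := commute_a₁_sq_b₁ (r := r) (s := s) (t := t) (u := u)
  have hmain := cohomology_subgroup (x := a₁ r s t u ^ 2) S ((hS _).2 (by simp [ha, sq]))
    ((hS _).2 (by simp [hb])) (.inl (by rw [hAb.eq, mul_inv_cancel_right])) (fun g hg => ?_)
    (torus_free hdet) hη
  · exact ⟨hmain.1, hmain.2.1, hmain.2.2.1⟩
  · obtain ⟨τ, hτ, k, hk⟩ :=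
      exists_torus_mul_zpow hdet a₁_conj_b₁ a₂_sq a₂_conj closure_generators g
    have hact := reflection_action_apply ha hb hc hτ k 0
    rw [hS] at hg
    rcases hk with rfl | rfl
    · obtain rfl : k = 0 := by linarith [hact.1]
      rw [zpow_zero, mul_one]
      exact exists_zpow_mul_zpow_of_mem_closure hAb hτ
    · have := hact.2
      omega

/-- A crossed homomorphism vanishing at `b₁` vanishes at `a₁`, hence at `a₁^{2t} b₁^u`, hence at
`a₂`, by the relations of conjugation. -/
theorem natCard_H1 (hdet : (r * u - s * t) ^ 2 = 1) (hη : η (b₁ r s t u) = -1) :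
    Nat.card (groupCohomology (twistedInt η) 1) = 2 := by
  refine natCard_H1_twistedInt hη fun f hf hfb => ?_
  have hb : b₁ r s t u ∈ hf.ker := hfb
  have ha : a₁ r s t u ∈ hf.ker := hf.mem_ker_of_conj hη hb (by
    rw [a₁_conj_b₁]
    exact inv_mem hb)
  have hd : a₁ r s t u ^ (2 * t) * b₁ r s t u ^ u ∈ hf.ker :=
    mul_mem (zpow_mem ha _) (zpow_mem hb _)
  have hc : a₂ r s t u ∈ hf.ker := hf.mem_ker_of_conj (map_torus hη hdet) hd (by
    rw [a₂_conj]
    exact inv_mem hd)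
  have htop : hf.ker = ⊤ := by
    rw [eq_top_iff, ← closure_generators, Subgroup.closure_le]
    rintro _ (rfl | rfl | rfl)
    exacts [ha, hb, hc]
  funext g
  have : g ∈ hf.ker := by
    rw [htop]
    exact Subgroup.mem_top g
  exact this

theorem reflection_action_transitive {p q : ℤ} {φ : G r s t u →* Equiv.Perm ℤ}
    (ha : φ (a₁ r s t u) = Equiv.subLeft p) (hb : φ (b₁ r s t u) = 1)
    (hc : φ (a₂ r s t u) = Equiv.subLeft q)
    (hpq : ∀ x : ℤ, ∃ k : ℤ, k * (q - p) = x ∨ p + k * (q - p) = x) (x : ℤ) :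
    ∃ g, φ g 0 = x := by
  have h (k : ℤ) := reflection_action_apply ha hb hc (one_mem _) k 0
  obtain ⟨k, hk | hk⟩ := hpq x
  · exact ⟨_, (h k).1.trans (by rw [zero_add, hk])⟩
  · exact ⟨_, (h k).2.trans (by rw [sub_zero, hk])⟩

/-- A map `ℤ → ℤ` which commutes with the generators is equivariant. -/
theorem map_equivariant {φ ψ : G r s t u →* Equiv.Perm ℤ} {π : ℤ → ℤ}
    (ha : ∀ e, π (φ (a₁ r s t u) e) = ψ (a₁ r s t u) (π e))
    (hb : ∀ e, π (φ (b₁ r s t u) e) = ψ (b₁ r s t u) (π e))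
    (hc : ∀ e, π (φ (a₂ r s t u) e) = ψ (a₂ r s t u) (π e)) (g : G r s t u) :
    ∀ e, π (φ g e) = ψ g (π e) := by
  have hg : g ∈ Subgroup.closure {a₁ r s t u, b₁ r s t u, a₂ r s t u} := by
    rw [closure_generators]
    exact Subgroup.mem_top g
  induction hg using Subgroup.closure_induction with
  | mem g hg =>
    rcases hg with rfl | rfl | rfl
    exacts [ha, hb, hc]
  | one => simp
  | mul g h _ _ hg hh => simp [hg, hh]
  | inv g _ hg =>
    intro e
    rw [map_inv, map_inv, Equiv.Perm.eq_inv_iff_eq, ← hg, ← Equiv.Perm.mul_apply, mul_inv_cancel,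
      Equiv.Perm.one_apply]

/-- The stabiliser of `0` for an action on `ℤ`. -/
def stabZero {Γ : Type} [Group Γ] (φ : Γ →* Equiv.Perm ℤ) : Subgroup Γ :=
  (MulAction.stabilizer (Equiv.Perm ℤ) (0 : ℤ)).comap φ

theorem mem_stabZero {Γ : Type} [Group Γ] {φ : Γ →* Equiv.Perm ℤ} {g : Γ} :
    g ∈ stabZero φ ↔ φ g 0 = 0 := Iff.rfl

end Stabilisers

end Sapphire

open Sapphire in
theorem mainTheorem5 (r s t u : ℤ) (hdet : r * u - s * t = 1 ∨ r * u - s * t = -1)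
    (hrstu : r * s * t * u ≠ 0)
    (η : Sapphire.G r s t u →* ℤˣ) (hη : η (Sapphire.b₁ r s t u) = -1) :
    Even s ∧
    Subsingleton (groupCohomology (Sapphire.twistedInt η) 0) ∧
    Nonempty (groupCohomology (Sapphire.twistedInt η) 1 ≃+ ZMod 2) ∧
    Nonempty (groupCohomology (Sapphire.twistedInt η) 2 ≃+ ZMod 2 × ZMod 2) ∧
    Nonempty (groupCohomology (Sapphire.twistedInt η) 3 ≃+ ZMod 2) := by
  have hdet' : (r * u - s * t) ^ 2 = 1 := by
    rcases hdet with h | h <;> rw [h] <;> norm_num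
  have hH1 := natCard_H1 hdet' hη
  -- On the line `a₁` is the reflection `x ↦ -x` and `a₂` is `x ↦ 2 - x`. In terms of the indices
  -- `j` of the vertices `2 * j`, `j` of the vertices `2 * j + 1`, and `e` of the edges `[e, e + 1]`,
  -- this gives the following three actions.
  obtain ⟨φ₀, a0, b0, c0⟩ := exists_reflection_action r s t u 0 1
  obtain ⟨φ₁, a1, b1, c1⟩ := exists_reflection_action r s t u (-1) 0
  obtain ⟨φE, aE, bE, cE⟩ := exists_reflection_action r s t u (-1) 1
  have shapiro {p q : ℤ} {φ : G r s t u →* Equiv.Perm ℤ}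
      (ha : φ (a₁ r s t u) = Equiv.subLeft p) (hb : φ (b₁ r s t u) = 1)
      (hc : φ (a₂ r s t u) = Equiv.subLeft q)
      (hpq : ∀ x : ℤ, ∃ k : ℤ, k * (q - p) = x ∨ p + k * (q - p) = x) (n : ℕ) :
      Nonempty (groupCohomology (Rep.of (funRep φ (twistedRep η))) n ≃+
        groupCohomology (twistedInt (η.comp (stabZero φ).subtype)) n) :=
    nonempty_groupCohomology_funRep φ (twistedRep η) 0 (stabZero φ) (fun _ => mem_stabZero)
      (reflection_action_transitive ha hb hc hpq) n
  have sh₀ := shapiro a0 b0 c0 fun x => ⟨x, .inl (by ring)⟩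
  have sh₁ := shapiro a1 b1 c1 fun x => ⟨x, .inl (by ring)⟩
  have shE := shapiro aE bE cE fun x => by
    obtain ⟨j, h | h⟩ := x.even_or_odd'
    · exact ⟨j, .inl (by omega)⟩
    · exact ⟨j + 1, .inr (by omega)⟩
  obtain ⟨hV₀1, hV₀2, hV₀3⟩ :=
    cohomology_even_vertex hdet' hη a0 b0 c0 (stabZero φ₀) fun _ => mem_stabZero
  obtain ⟨hV₁1, hV₁2, hV₁3⟩ :=
    cohomology_odd_vertex hdet' hη a1 b1 c1 (stabZero φ₁) fun _ => mem_stabZero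
  obtain ⟨hE0, hE1, hE2⟩ := cohomology_edge hdet' hη aE bE cE (stabZero φE) fun _ => mem_stabZero
  obtain ⟨φ, ψ, δ, hφψ, hψδ, hδφ⟩ := exists_line_sequence (φ₀ := φ₀) (φ₁ := φ₁) (φE := φE)
    (map_equivariant (π := fun e => (e + 1) / 2)
      (fun e => by simp only [aE, a0, Equiv.subLeft_apply]; omega)
      (fun e => by simp [bE, b0])
      fun e => by simp only [cE, c0, Equiv.subLeft_apply]; omega)
    (map_equivariant (π := fun e => e / 2)
      (fun e => by simp only [aE, a1, Equiv.subLeft_apply]; omega)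
      (fun e => by simp [bE, b1])
      fun e => by simp only [cE, c1, Equiv.subLeft_apply]; omega)
    (twistedRep η)
  -- The cohomology of the middle term.
  have hV (n : ℕ) : Nonempty
      (groupCohomology (Rep.of ((funRep φ₀ (twistedRep η)).prod (funRep φ₁ (twistedRep η)))) n ≃+
        groupCohomology (twistedInt (η.comp (stabZero φ₀).subtype)) n ×
        groupCohomology (twistedInt (η.comp (stabZero φ₁).subtype)) n) := by
    obtain ⟨e⟩ := nonempty_groupCohomology_prod (funRep φ₀ (twistedRep η))
      (funRep φ₁ (twistedRep η)) n
    exact ⟨e.trans ((sh₀ n).some.prodCongr (sh₁ n).some)⟩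
  have hV1 := Nat.card_congr (hV 1).some.toEquiv
  have hV2 := Nat.card_congr (hV 2).some.toEquiv
  rw [Nat.card_prod, hV₀1, hV₁1] at hV1
  rw [Nat.card_prod, hV₀2, hV₁2] at hV2
  have hV3 : Subsingleton (groupCohomology (Rep.of
      ((funRep φ₀ (twistedRep η)).prod (funRep φ₁ (twistedRep η)))) 3) :=
    (hV 3).some.toEquiv.subsingleton
  have hE0' : Subsingleton (groupCohomology (Rep.of (funRep φE (twistedRep η))) 0) :=
    (shE 0).some.toEquiv.subsingleton
  have hE1' := (Nat.card_congr (shE 1).some.toEquiv).trans hE1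
  have hE2' := (Nat.card_congr (shE 2).some.toEquiv).trans hE2
  have : Finite (groupCohomology (Rep.of
      ((funRep φ₀ (twistedRep η)).prod (funRep φ₁ (twistedRep η)))) 1) :=
    Nat.finite_of_card_ne_zero (by rw [hV1]; norm_num)
  have : Finite (groupCohomology (Rep.of
      ((funRep φ₀ (twistedRep η)).prod (funRep φ₁ (twistedRep η)))) 2) :=
    Nat.finite_of_card_ne_zero (by rw [hV2]; norm_num)
  have : Finite (groupCohomology (Rep.of (funRep φE (twistedRep η))) 1) :=
    Nat.finite_of_card_ne_zero (by rw [hE1']; norm_num)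
  -- `H¹(G) → H¹(V)` has image of order two, so `H¹(V) → H¹(E)` is onto by counting.
  have hψ1 : Function.Surjective (ψ 1) := by
    have hker : (ψ 1).ker = (φ 1).range := AddSubgroup.ext fun x => hφψ 1 x
    have hle : Nat.card (ψ 1).ker ≤ 2 := by
      have : Finite (groupCohomology (Rep.of (twistedRep η)) 1) :=
        Nat.finite_of_card_ne_zero (hH1.trans_ne two_ne_zero)
      rw [hker]
      exact (Nat.card_le_card_of_surjective _ (φ 1).rangeRestrict_surjective).trans hH1.le
    have hmul := AddSubgroup.card_eq_card_quotient_mul_card_addSubgroup (ψ 1).ker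
    rw [Nat.card_congr (QuotientAddGroup.quotientKerEquivRange (ψ 1)).toEquiv, hV1] at hmul
    rw [← AddMonoidHom.range_eq_top]
    refine AddSubgroup.eq_top_of_le_card _ ?_
    rw [hE1']
    by_contra hlt
    have := Nat.mul_le_mul (show Nat.card (ψ 1).range ≤ 1 by omega) hle
    omega
  -- Hence `H²(G) → H²(V)` is injective, and it is bijective because `H²(G)` has four elements.
  have hφ2 : Function.Injective (φ 2) := (injective_iff_map_eq_zero _).2 fun x hx => by
    obtain ⟨y, rfl⟩ := (hδφ 1 x).1 hx
    exact (hψδ 1 y).2 (hψ1 y)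
  have : Finite (groupCohomology (twistedInt η) 2) := Finite.of_injective _ hφ2
  have h4 := four_le_natCard_H2 hη hH1
  have hφ2' : Function.Bijective (φ 2) := hφ2.bijective_of_nat_card_le (by rw [hV2]; exact h4)
  -- Therefore `H²(V) → H²(E)` is zero and `H²(E) → H³(G)` is bijective.
  have hδ2 : Function.Bijective (δ 2) := by
    refine ⟨(injective_iff_map_eq_zero _).2 fun x hx => ?_, fun x => ?_⟩
    · obtain ⟨y, rfl⟩ := (hψδ 2 x).1 hx
      exact (hφψ 2 y).2 (hφ2'.2 y)
    · exact (hδφ 2 x).1 (Subsingleton.elim _ _)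
  refine ⟨even_of_map_b₁ hη, subsingleton_H0_twistedInt η hη, nonempty_addEquiv_zmod_two hH1,
    ?_, nonempty_addEquiv_zmod_two
      ((Nat.card_congr (Equiv.ofBijective _ hδ2)).symm.trans hE2')⟩
  obtain ⟨e₀⟩ := nonempty_addEquiv_zmod_two hV₀2
  obtain ⟨e₁⟩ := nonempty_addEquiv_zmod_two hV₁2
  exact ⟨((AddEquiv.ofBijective (φ 2) hφ2').trans (hV 2).some).trans (e₀.prodCongr e₁)⟩
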